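/- Fix a finite set of $m\ge 0$ agents. Epistemic formulas are $\varphi ::= p \mid \neg\varphi \mid \varphi\vee\varphi \mid K_i\varphi$ ($p$ an atomic proposition, $i$ an agent), interpreted in finite epistemic models $\mathcal M=(W,\{R_i\}_i,V)$ with arbitrary accessibility relations $R_i\subseteq W\times W$ and a valuation $V$; $K_i\varphi$ holds at $w$ iff $\varphi$ holds at every $w'$ with $w\,R_i\,w'$. An event model $\mathcal E=(E,\{S_i\}_i,\mathrm{pre},\mathrm{post})$ has a finite set $E$ of events, relations $S_i\subseteq E\times E$, and formulas $\mathrm{pre}(e)$ and $\mathrm{post}(e)(p)$; it is propositional if none of these formulas contains a modality $K_i$. The update product $\mathcal M\otimes\mathcal E$ has as worlds the pairs $(w,e)$ with $\mathcal M,w\models\mathrm{pre}(e)$, the relations $(w,e)\to_i(w',e')$ iff $w\,R_i\,w'$ and $e\,S_i\,e'$, and $p$ true at $(w,e)$ iff $\mathcal M,w\models\mathrm{post}(e)(p)$; for pointed models, $(\mathcal M,w)\otimes(\mathcal E,e)=(\mathcal M\otimes\mathcal E,(w,e))$ if $\mathcal M,w\models\mathrm{pre}(e)$, and it is undefined otherwise.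 An instance of the propositional epistemic planning problem consists of a finite set $AP$ of atomic propositions (not fixed), a pointed finite epistemic model $(\mathcal M,w)$, a propositional event model $\mathcal E$, a set $E'\subseteq E$ of events and a goal formula $\varphi$. A solution plan is a finite (possibly empty) word $e_1\cdots e_n$ over $E'$ such that $(\mathcal M,w)\otimes(\mathcal E,e_1)\otimes\cdots\otimes(\mathcal E,e_n)$ is defined and satisfies $\varphi$. The problem asks whether a solution plan exists. The size of an instance is $$|W|+\sum_i|R_i|+\sum_i|S_i|+\sum_{e\in E}\Big(|\mathrm{pre}(e)|+\sum_{p\in AP}|\mathrm{post}(e)(p)|\Big)+|E'|+|\varphi|+|AP|,$$ where the size of a formula is its number of atoms, connectives and modalities. Theorem. Let $k\ge 0$. Restricted to the instances whose goal formula has knowledge-nesting depth at most $k$, the propositional epistemic planning problem is in $(k+1)$-EXPTIME: a Turing machine decides it in a number of steps at most $\exp_{k+1}(p(s))$ for some polynomial $p$, where $s$ is the size of the instance, $\exp_0(x)=x$ and $\exp_{j+1}(x)=2^{\exp_j(x)}$. Moreover, within a time bound of the same form, a Turing machine can build from such an instance a finite deterministic word automaton over the alphabet $E$ that recognizes exactly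 the set of all solution plans. -/

import Mathlib

/-! ### Epistemic formulas -/

/-- Formulas of the epistemic language: propositional logic with one knowledge modality for each
agent. -/
inductive ELFormula (Agent AP : Type) : Type where
  | atom : AP → ELFormula Agent AP
  | neg : ELFormula Agent AP → ELFormula Agent AP
  | or : ELFormula Agent AP → ELFormula Agent AP → ELFormula Agent AP
  | know : Agent → ELFormula Agent AP → ELFormula Agent AP

namespace ELFormula

variable {Agent AP : Type}

/-- The formula lies in the propositional fragment: no knowledge modality occurs in it. -/
def IsPropositional : ELFormula Agent AP → Prop
  | atom _ => True
  | neg φ => φ.IsPropositional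
  | or φ ψ => φ.IsPropositional ∧ ψ.IsPropositional
  | know _ _ => False

/-- The maximal number of nested knowledge modalities. -/
def depth : ELFormula Agent AP → ℕ
  | atom _ => 0
  | neg φ => φ.depth
  | or φ ψ => max φ.depth ψ.depth
  | know _ φ => φ.depth + 1

/-- The size of a formula: its number of atoms, connectives and modalities. -/
def size : ELFormula Agent AP → ℕ
  | atom _ => 1
  | neg φ => φ.size + 1
  | or φ ψ => φ.size + ψ.size + 1
  | know _ φ => φ.size + 1

end ELFormula

/-! ### Epistemic models, event models, update product

The type of worlds and the type of events are parameters. In a planning instance both are finite. -/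

/-- An epistemic model with set of worlds `World`: an arbitrary accessibility relation for each
agent, and a valuation. -/
structure EpistemicModel (Agent AP World : Type) where
  rel : Agent → World → World → Prop
  val : AP → Set World

/-- An event model with set of events `Event`: an arbitrary accessibility relation for each agent,
preconditions and postconditions. -/
structure EventModel (Agent AP Event : Type) where
  rel : Agent → Event → Event → Prop
  pre : Event → ELFormula Agent AP
  post : Event → AP → ELFormula Agent AP

namespace EpistemicModel

variable {Agent AP World Event : Type}

/-- Truth of an epistemic formula at a world of an epistemic model. -/
def Sat (M : EpistemicModel Agent AP World) : World → ELFormula Agent AP → Prop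
  | w, .atom p => w ∈ M.val p
  | w, .neg φ => ¬ M.Sat w φ
  | w, .or φ ψ => M.Sat w φ ∨ M.Sat w ψ
  | w, .know i φ => ∀ w', M.rel i w w' → M.Sat w' φ

/-- The update product of an epistemic model and an event model. -/
def update (M : EpistemicModel Agent AP World) (E : EventModel Agent AP Event) :
    EpistemicModel Agent AP {x : World × Event // M.Sat x.1 (E.pre x.2)} where
  rel i x y := M.rel i x.1.1 y.1.1 ∧ E.rel i x.1.2 y.1.2
  val p := {x | M.Sat x.1.1 (E.post x.1.2 p)}

end EpistemicModel

/-- `Achieves E φ π M w`: the successive update products of the pointed epistemic model `(M, w)`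
with the pointed event models `(E, e₁), …, (E, eₙ)`, where `π = [e₁, …, eₙ]`, are all defined, and
the pointed epistemic model that results satisfies `φ`. -/
def Achieves {Agent AP Event : Type} (E : EventModel Agent AP Event) (φ : ELFormula Agent AP) :
    List Event → ∀ {World : Type}, EpistemicModel Agent AP World → World → Prop
  | [], _, M, w => M.Sat w φ
  | e :: π, _, M, w =>
      ∃ h : M.Sat w (E.pre e), Achieves E φ π (M.update E) ⟨(w, e), h⟩

/-- An event model is propositional if all its preconditions and postconditions are. -/
def EventModel.IsPropositional {Agent AP Event : Type} (E : EventModel Agent AP Event) : Prop :=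
  ∀ e, (E.pre e).IsPropositional ∧ ∀ p, (E.post e p).IsPropositional

/-! ### The epistemic planning problem -/

/-- An instance of the epistemic planning problem over a fixed set of `m` agents: finitely many
atomic propositions, a finite pointed epistemic model, a finite event model, a set of events that
plans may use, and a goal formula. -/
structure PlanningInstance (m : ℕ) where
  numAtoms : ℕ
  numWorlds : ℕ
  numEvents : ℕ
  model : EpistemicModel (Fin m) (Fin numAtoms) (Fin numWorlds)
  start : Fin numWorlds
  eventModel : EventModel (Fin m) (Fin numAtoms) (Fin numEvents)
  allowed : Set (Fin numEvents)
  goal : ELFormula (Fin m) (Fin numAtoms)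

namespace PlanningInstance

variable {m : ℕ}

/-- The solution plans, as a language over the alphabet of events. -/
def solutionPlans (I : PlanningInstance m) : Language (Fin I.numEvents) :=
  {π | (∀ e ∈ π, e ∈ I.allowed) ∧ Achieves I.eventModel I.goal π I.model I.start}

/-- The question of the planning problem: is there a solution plan? -/
def Solvable (I : PlanningInstance m) : Prop :=
  ∃ π : List (Fin I.numEvents), π ∈ I.solutionPlans

/-- The size of an instance: the number of worlds and of edges of the epistemic model, plus the
number of edges of the event model and the sizes of its preconditions and postconditions, plus the
number of events that plans may use, the size of the goal, and the number of atomic propositions. -/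
noncomputable def size (I : PlanningInstance m) : ℕ :=
  (I.numWorlds + ∑ i, Set.ncard {x : Fin I.numWorlds × Fin I.numWorlds | I.model.rel i x.1 x.2})
  + (∑ i, Set.ncard {x : Fin I.numEvents × Fin I.numEvents | I.eventModel.rel i x.1 x.2}
      + ∑ e, ((I.eventModel.pre e).size + ∑ p, (I.eventModel.post e p).size))
  + I.allowed.ncard + I.goal.size + I.numAtoms

end PlanningInstance

/-- Instances of the propositional epistemic planning problem whose goal formula has nesting depth
at most `k`. -/
abbrev PropPlanningInstance (m k : ℕ) : Type :=
  {I : PlanningInstance m // I.eventModel.IsPropositional ∧ I.goal.depth ≤ k}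

/-! ### Instances and automata as words over a finite alphabet -/

/-- The input alphabet. -/
inductive InputSymbol : Type where
  | zero | one | atom | neg | or | know
  deriving DecidableEq

namespace InputSymbol

/-- Self-delimiting unary notation. -/
def unary (n : ℕ) : List InputSymbol := List.replicate n one ++ [zero]

open Classical in
/-- The truth value of a proposition, as one symbol. -/
noncomputable def bit (P : Prop) : InputSymbol := if P then one else zero

end InputSymbol

/-- Formulas in prefix notation; agents and atoms are in unary. -/
def ELFormula.encode {m a : ℕ} : ELFormula (Fin m) (Fin a) → List InputSymbol
  | .atom p => .atom :: InputSymbol.unary p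
  | .neg φ => .neg :: φ.encode
  | .or φ ψ => .or :: (φ.encode ++ ψ.encode)
  | .know i φ => .know :: (InputSymbol.unary i ++ φ.encode)

open InputSymbol in
/-- The word that describes an instance: the cardinalities and the initial world in unary,
adjacency matrices for the relations, bit tables for the valuation and the allowed events, and
the formulas. -/
noncomputable def PlanningInstance.encode {m : ℕ} (I : PlanningInstance m) : List InputSymbol :=
  unary I.numAtoms ++ unary I.numWorlds ++ unary I.numEvents ++ unary I.start
  ++ ((List.finRange m).flatMap fun i => (List.finRange I.numWorlds).flatMap fun w =>
      (List.finRange I.numWorlds).map fun w' => bit (I.model.rel i w w'))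
  ++ ((List.finRange I.numAtoms).flatMap fun p =>
      (List.finRange I.numWorlds).map fun w => bit (w ∈ I.model.val p))
  ++ ((List.finRange m).flatMap fun i => (List.finRange I.numEvents).flatMap fun e =>
      (List.finRange I.numEvents).map fun e' => bit (I.eventModel.rel i e e'))
  ++ ((List.finRange I.numEvents).flatMap fun e => (I.eventModel.pre e).encode
      ++ (List.finRange I.numAtoms).flatMap fun p => (I.eventModel.post e p).encode)
  ++ ((List.finRange I.numEvents).map fun e => bit (e ∈ I.allowed))
  ++ I.goal.encode

namespace DFA

/-- Self-delimiting unary notation over `Bool`. -/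
def unaryBool (n : ℕ) : List Bool := List.replicate n true ++ [false]

open Classical in
/-- The word over `Bool` that describes a deterministic automaton with states `Fin q` over the
alphabet `Fin a`: the two cardinalities and the initial state in unary, the bit table of the
accepting states, and the transition table with its entries in unary. -/
noncomputable def encodeFin {a q : ℕ} (A : DFA (Fin a) (Fin q)) : List Bool :=
  unaryBool a ++ unaryBool q ++ unaryBool A.start
  ++ ((List.finRange q).map fun s => decide (s ∈ A.accept))
  ++ ((List.finRange q).flatMap fun s => (List.finRange a).flatMap fun e =>
      unaryBool (A.step s e))

end DFA

/-! ### Iterated exponential time on Turing machines -/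

/-- The `j`-fold iterated exponential: `expTower 0 n = n`, `expTower (j + 1) n = 2 ^ expTower j n`. -/
def expTower : ℕ → ℕ → ℕ
  | 0, n => n
  | j + 1, n => 2 ^ expTower j n

/-- Some multi-stack Turing machine, on the input word `enc a`, halts with the output word `out a`
after a number of steps that is at most `j`-fold exponential in a polynomial of `size a`. The
machine and the polynomial are the same for all `a`. -/
def ComputableInExpTime {α Γ Δ : Type} (j : ℕ) (enc : α → List Γ) (size : α → ℕ)
    (out : α → List Δ) : Prop :=
  ∃ (M : Turing.TM2ComputableAux Γ Δ) (p : Polynomial ℕ), ∀ a : α,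
    Nonempty (Turing.TM2OutputsInTime M.tm ((enc a).map M.inputAlphabet.invFun)
      (some ((out a).map M.outputAlphabet.invFun)) (expTower j (p.eval (size a))))

open Classical in
/-- The problem `P` is in `j`-EXPTIME: the one-letter word with the answer to `P a` can be computed
in `j`-fold exponential time. -/
def InExpTime {α Γ : Type} (j : ℕ) (enc : α → List Γ) (size : α → ℕ) (P : α → Prop) : Prop :=
  ComputableInExpTime j enc size fun a => [decide (P a)]

/-! ### Stack programs

Turing machines with six stacks are assembled from small programs. -/

/-! The type of depth d of a pointed model records the true atoms and, if d > 0, for each agent the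
set of types of depth d - 1 of the successors. A formula of modal depth at most d is decided by the
type of depth d (`sat_typeAt`). Since pre- and postconditions are propositional, they depend only on
the true atoms of a world. The successors of (u, e) are the pairs of a successor u' of u and a
successor e' of e whose precondition holds at u', and this is visible in the type of u'. Hence the
type of depth k after the event is a function of the type of depth k before it and of the event,
with no loss of depth (`updTy_typeAt`). Although the models grow along a plan, only the type of
depth k has to be remembered.

The types of depth k, with a rejecting sink for events that are forbidden or not executable, are
therefore the states of a deterministic automaton that accepts exactly the solution plans
(`automaton_accepts`). There are 2^a types of depth 0, where a is the number of atoms, and 2^a *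
2^(m * N) types of depth d + 1, where N is the number of types of depth d. For a fixed number m of
agents this is a (k + 1)-fold exponential. Solvability is reachability of an accepting state, and a
shortest witness is no longer than the number of states (`exists_short_mem_accepts`).

For equality of types to be equality of data, a set of types is stored as a sublist of the list
`allTypes`, in the order of that list.

The time bound rests on a calculus of running times. Data are binary trees in prefix code on a
stack. Stack programs for pairing, projections, case distinction, equality and folds yield closure
properties of `PolyTime`, and every program becomes a Turing machine. The one exponential operation
is the power set (`towerTime_sublists'`). It adds one exponential at each of the k + 1 depths
(`Env.towerTime_mk`), and everything else is polynomial in the size of the tables of types. The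
input word is evaluated from right to left, so that formulas in prefix notation need only a stack of
truth values. -/

instance : Fintype InputSymbol where
  elems := {.zero, .one, .atom, .neg, .or, .know}
  complete := by intro x; cases x <;> decide

namespace StackMachine

/-- The stacks: input, output, a stack of encoded trees, and three auxiliary stacks. -/
inductive Reg : Type where
  | inp | out | main | a | b | c
  deriving DecidableEq

instance : Fintype Reg where
  elems := {.inp, .out, .main, .a, .b, .c}
  complete := by intro x; cases x <;> decide

/-- The alphabet of each stack. -/
abbrev Sym : Reg → Type
  | .inp => InputSymbol
  | .out => Bool
  | .main => Bool
  | .a => Bool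
  | .b => Bool
  | .c => Bool

instance : ∀ r, Fintype (Sym r)
  | .inp => inferInstanceAs (Fintype InputSymbol)
  | .out => inferInstanceAs (Fintype Bool)
  | .main => inferInstanceAs (Fintype Bool)
  | .a => inferInstanceAs (Fintype Bool)
  | .b => inferInstanceAs (Fintype Bool)
  | .c => inferInstanceAs (Fintype Bool)

/-- The contents of the stacks. -/
abbrev Store : Type := ∀ r, List (Sym r)

/-- The store with the given contents. -/
def store (i : List InputSymbol) (o m a b c : List Bool) : Store
  | .inp => i
  | .out => o
  | .main => m
  | .a => a
  | .b => b
  | .c => c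

section store

variable (i : List InputSymbol) (o m a b c : List Bool)

@[simp] theorem store_inp : store i o m a b c .inp = i := rfl
@[simp] theorem store_out : store i o m a b c .out = o := rfl
@[simp] theorem store_main : store i o m a b c .main = m := rfl
@[simp] theorem store_a : store i o m a b c .a = a := rfl
@[simp] theorem store_b : store i o m a b c .b = b := rfl
@[simp] theorem store_c : store i o m a b c .c = c := rfl

@[simp] theorem update_store_inp (x) :
    Function.update (store i o m a b c) .inp x = store x o m a b c := by
  funext r; cases r <;> simp [Function.update]

@[simp] theorem update_store_out (x) :
    Function.update (store i o m a b c) .out x = store i x m a b c := by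
  funext r; cases r <;> simp [Function.update]

@[simp] theorem update_store_main (x) :
    Function.update (store i o m a b c) .main x = store i o x a b c := by
  funext r; cases r <;> simp [Function.update]

@[simp] theorem update_store_a (x) :
    Function.update (store i o m a b c) .a x = store i o m x b c := by
  funext r; cases r <;> simp [Function.update]

@[simp] theorem update_store_b (x) :
    Function.update (store i o m a b c) .b x = store i o m a x c := by
  funext r; cases r <;> simp [Function.update]

@[simp] theorem update_store_c (x) :
    Function.update (store i o m a b c) .c x = store i o m a b x := by
  funext r; cases r <;> simp [Function.update]

end store

/-- Elementary operations; the label `none` is the exit. -/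
inductive Op (Λ : Type) : Type where
  | push (r : Reg) (x : Sym r) (next : Option Λ)
  | pop (r : Reg) (next : Option (Sym r) → Option Λ)

namespace Op

variable {Λ Λ' : Type}

/-- Redirects the jumps of an operation. -/
def map (f : Option Λ → Option Λ') : Op Λ → Op Λ'
  | push r x n => push r x (f n)
  | pop r n => pop r fun o => f (n o)

/-- The label reached and the new store. -/
def exec : Op Λ → Store → Option Λ × Store
  | push r x n, S => (n, Function.update S r (x :: S r))
  | pop r n, S => (n (S r).head?, Function.update S r (S r).tail)

theorem exec_map (f : Option Λ → Option Λ') (q : Op Λ) (S : Store) :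
    (q.map f).exec S = (f (q.exec S).1, (q.exec S).2) := by
  cases q <;> rfl

end Op

/-- A program: finitely many labels with an operation each, and an entry point. -/
structure Prog where
  Λ : Type
  [fin : Fintype Λ]
  entry : Option Λ
  op : Λ → Op Λ

namespace Prog

attribute [instance] Prog.fin

/-- One step of a program. -/
def step (G : Prog) : Option G.Λ × Store → Option G.Λ × Store
  | (none, S) => (none, S)
  | (some l, S) => (G.op l).exec S

/-- The program reaches its exit within `n` steps. -/
def Runs (G : Prog) (S S' : Store) (n : ℕ) : Prop :=
  G.step^[n] (G.entry, S) = (none, S')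

theorem step_iterate_none (G : Prog) (S : Store) (n : ℕ) :
    G.step^[n] (none, S) = (none, S) :=
  Function.iterate_fixed rfl n

/-- The exit is a fixed point of `step`. So `Runs` is an upper bound on the running time, and all
later estimates may be generous. -/
theorem Runs.mono {G : Prog} {S S' : Store} {n n' : ℕ} (h : G.Runs S S' n) (hn : n ≤ n') :
    G.Runs S S' n' := by
  obtain ⟨d, rfl⟩ := Nat.exists_eq_add_of_le' hn
  rw [Runs, Function.iterate_add_apply, h, step_iterate_none]

/-- A program that is embedded in another one runs there until it jumps to its exit, which is
redirected to `x`. -/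
theorem step_iterate_embed {G H : Prog} (f : G.Λ → H.Λ) (x : Option H.Λ)
    (hf : ∀ l, H.op (f l) = (G.op l).map fun o => o.elim x fun l => some (f l))
    {n : ℕ} {e : Option G.Λ} {S S' : Store} (h : G.step^[n] (e, S) = (none, S')) :
    ∃ n' ≤ n, H.step^[n'] (e.elim x fun l => some (f l), S) = (x, S') := by
  induction n generalizing e S with
  | zero =>
    obtain ⟨rfl, rfl⟩ := Prod.mk.inj h
    exact ⟨0, le_rfl, rfl⟩
  | succ n ih =>
    cases e with
    | none =>
      rw [step_iterate_none] at h
      obtain ⟨-, rfl⟩ := Prod.mk.inj h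
      exact ⟨0, Nat.zero_le _, rfl⟩
    | some l =>
      rw [Function.iterate_succ_apply] at h
      obtain ⟨n', hn, h'⟩ := ih (e := ((G.op l).exec S).1) (S := ((G.op l).exec S).2) h
      refine ⟨n' + 1, Nat.succ_le_succ hn, ?_⟩
      rw [Function.iterate_succ_apply, ← h']
      congr 1
      change (H.op (f l)).exec S = _
      rw [hf, Op.exec_map]

/-- The program that does nothing. -/
def skip : Prog where
  Λ := Empty
  entry := none
  op := Empty.elim

theorem runs_skip (S : Store) : skip.Runs S S 0 := rfl

/-- Push one symbol. -/
def push (r : Reg) (x : Sym r) : Prog where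
  Λ := Unit
  entry := some ()
  op _ := .push r x none

theorem runs_push (r : Reg) (x : Sym r) (S : Store) :
    (push r x).Runs S (Function.update S r (x :: S r)) 1 := rfl

/-- Sequential composition. -/
def seq (G H : Prog) : Prog where
  Λ := G.Λ ⊕ H.Λ
  entry := G.entry.elim (H.entry.elim none fun l => some (.inr l)) fun l => some (.inl l)
  op
    | .inl l => (G.op l).map fun o =>
        o.elim (H.entry.elim none fun l => some (.inr l)) fun l => some (.inl l)
    | .inr l => (H.op l).map fun o => o.elim none fun l => some (.inr l)

/-- Exits of the first program are redirected to the entry of the second, so that composition costs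
no extra step. -/
theorem Runs.seq {G H : Prog} {S S' S'' : Store} {n n' : ℕ} (h : G.Runs S S' n)
    (h' : H.Runs S' S'' n') : (G.seq H).Runs S S'' (n + n') := by
  obtain ⟨i, hi, h₁⟩ := step_iterate_embed (H := G.seq H) Sum.inl
    (H.entry.elim none fun l => some (.inr l)) (fun _ => rfl) h
  obtain ⟨j, hj, h₂⟩ := step_iterate_embed (H := G.seq H) Sum.inr none (fun _ => rfl) h'
  have : (G.seq H).Runs S S'' (j + i) := by
    rw [Runs, Function.iterate_add_apply]
    exact (congrArg _ h₁).trans h₂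
  exact this.mono (by omega)

/-- Pop a symbol from the stack `r` and run a program that depends on it; then start again, or
exit. -/
def node (r : Reg) (body : Option (Sym r) → Prog) (again : Option (Sym r) → Bool) : Prog where
  Λ := Option (Σ x, (body x).Λ)
  entry := some none
  op
    | none => .pop r fun x =>
        (body x).entry.elim (bif again x then some none else none) fun l => some (some ⟨x, l⟩)
    | some ⟨x, l⟩ => ((body x).op l).map fun o =>
        o.elim (bif again x then some none else none) fun l => some (some ⟨x, l⟩)

section node

variable {r : Reg} {body : Option (Sym r) → Prog} {again : Option (Sym r) → Bool}

/-- One round of the loop; the additional step is the pop that selects the body. -/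
theorem step_iterate_node {S S' : Store} {n : ℕ} (x : Option (Sym r)) (hx : (S r).head? = x)
    (h : (body x).Runs (Function.update S r (S r).tail) S' n) :
    ∃ n' ≤ n + 1, (node r body again).step^[n'] (some none, S) =
      (bif again x then some none else none, S') := by
  obtain ⟨i, hi, h₁⟩ := step_iterate_embed (H := node r body again) (fun l => some ⟨x, l⟩)
    (bif again x then some none else none) (fun _ => rfl) h
  refine ⟨i + 1, Nat.succ_le_succ hi, ?_⟩
  subst hx
  rw [Function.iterate_succ_apply]
  exact h₁

theorem Runs.node_exit {S S' : Store} {n : ℕ} (x : Option (Sym r)) (hx : (S r).head? = x)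
    (h : (body x).Runs (Function.update S r (S r).tail) S' n) (hr : again x = false) :
    (node r body again).Runs S S' (n + 1) := by
  obtain ⟨i, hi, h₁⟩ := step_iterate_node (again := again) x hx h
  rw [hr] at h₁
  exact Runs.mono h₁ hi

theorem Runs.node_again {S S' S'' : Store} {n n' : ℕ} (x : Option (Sym r))
    (hx : (S r).head? = x)
    (h : (body x).Runs (Function.update S r (S r).tail) S' n) (hr : again x = true)
    (h' : (node r body again).Runs S' S'' n') : (node r body again).Runs S S'' (n + 1 + n') := by
  obtain ⟨i, hi, h₁⟩ := step_iterate_node (again := again) x hx h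
  rw [hr] at h₁
  have : (node r body again).Runs S S'' (n' + i) := by
    rw [Runs, Function.iterate_add_apply]
    exact (congrArg _ h₁).trans h'
  exact this.mono (by omega)

end node

/-! #### Programs as Turing machines -/

section machine

/-- The internal states of the machine: the symbol popped last. -/
abbrev State : Type := Option (InputSymbol ⊕ Bool)

/-- A symbol as internal state. -/
def toState : ∀ r, Option (Sym r) → State
  | .inp, o => o.map Sum.inl
  | .out, o => o.map Sum.inr
  | .main, o => o.map Sum.inr
  | .a, o => o.map Sum.inr
  | .b, o => o.map Sum.inr
  | .c, o => o.map Sum.inr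

/-- The symbol of an internal state. -/
def ofState : ∀ r, State → Option (Sym r)
  | .inp, s => s.bind Sum.getLeft?
  | .out, s => s.bind Sum.getRight?
  | .main, s => s.bind Sum.getRight?
  | .a, s => s.bind Sum.getRight?
  | .b, s => s.bind Sum.getRight?
  | .c, s => s.bind Sum.getRight?

theorem ofState_toState (r : Reg) (o : Option (Sym r)) : ofState r (toState r o) = o := by
  cases r <;> cases o <;> rfl

variable {Λ : Type}

/-- Jump to a label, or halt in the initial internal state. -/
def jump (l₀ : Λ) (n : State → Option Λ) : Turing.TM2.Stmt Sym Λ State :=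
  .branch (fun s => (n s).isSome) (.goto fun s => (n s).getD l₀) (.load (fun _ => none) .halt)

/-- An operation as a statement of a Turing machine. -/
def _root_.StackMachine.Op.toStmt (l₀ : Λ) : Op Λ → Turing.TM2.Stmt Sym Λ State
  | .push r x n => .push r (fun _ => x) (jump l₀ fun _ => n)
  | .pop r n => .pop r (fun _ o => toState r o) (jump l₀ fun s => n (ofState r s))

/-- The second conjunct is needed because `Turing.haltList` has the initial internal state, so the
symbol popped last must be forgotten on halting. -/
theorem stepAux_jump (l₀ : Λ) (n : State → Option Λ) (v : State) (S : Store) :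
    ∃ v', Turing.TM2.stepAux (jump l₀ n) v S = ⟨n v, v', S⟩ ∧ (n v = none → v' = none) := by
  cases h : n v with
  | none => exact ⟨none, by simp [jump, h], fun _ => rfl⟩
  | some l => exact ⟨v, by simp [jump, h], by simp⟩

theorem stepAux_toStmt (l₀ : Λ) (q : Op Λ) (v : State) (S : Store) :
    ∃ v', Turing.TM2.stepAux (q.toStmt l₀) v S = ⟨(q.exec S).1, v', (q.exec S).2⟩ ∧
      ((q.exec S).1 = none → v' = none) := by
  cases q with
  | push r x n => exact stepAux_jump l₀ (fun _ => n) v _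
  | pop r n =>
    have := stepAux_jump l₀ (fun s => n (ofState r s)) (toState r (S r).head?)
      (Function.update S r (S r).tail)
    simp only [ofState_toState] at this
    exact this

/-- The Turing machine of a program. -/
def toTM (G : Prog) (l₀ : G.Λ) : Turing.FinTM2 where
  K := Reg
  k₀ := .inp
  k₁ := .out
  Γ := Sym
  Λ := G.Λ
  main := l₀
  σ := State
  initialState := none
  m l := (G.op l).toStmt l₀

/-- An operation together with its jump is a single step of the machine, so the time bound carries
over unchanged. -/
theorem toTM_iterate (G : Prog) (l₀ l : G.Λ) (v : State) (S S' : Store) (n : ℕ)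
    (h : G.step^[n] (some l, S) = (none, S')) :
    ∃ n' ≤ n, (flip bind (G.toTM l₀).step)^[n'] (some ⟨some l, v, S⟩) =
      some ⟨none, none, S'⟩ := by
  induction n generalizing l v S with
  | zero => exact absurd (Prod.mk.inj h).1 (by simp)
  | succ n ih =>
    rw [Function.iterate_succ_apply] at h
    obtain ⟨v', hv, hv'⟩ := stepAux_toStmt l₀ (G.op l) v S
    have hs : (flip bind (G.toTM l₀).step) (some ⟨some l, v, S⟩) =
        some ⟨((G.op l).exec S).1, v', ((G.op l).exec S).2⟩ := congrArg some hv
    change G.step^[n] ((G.op l).exec S) = _ at h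
    rcases hq : (G.op l).exec S with ⟨o, T⟩
    rw [hq] at h hs hv'
    cases o with
    | none =>
      rw [step_iterate_none] at h
      obtain ⟨-, rfl⟩ := Prod.mk.inj h
      refine ⟨1, by omega, ?_⟩
      rw [Function.iterate_one, hs, hv' rfl]
      rfl
    | some l' =>
      obtain ⟨n', hn, h'⟩ := ih l' v' T h
      exact ⟨n' + 1, by omega, by rw [Function.iterate_succ_apply, hs]; exact h'⟩

end machine

end Prog

end StackMachine

/-! ### Programs on encoded binary trees -/

/-- Binary trees, the data that programs work on. -/
inductive BinTree : Type where
  | leaf : BinTree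
  | node : BinTree → BinTree → BinTree

namespace BinTree

/-- Prefix notation. -/
def code : BinTree → List Bool
  | leaf => [false]
  | node l r => true :: (l.code ++ r.code)

/-- The length of the prefix notation. -/
def size (t : BinTree) : ℕ := t.code.length

@[simp] theorem size_leaf : leaf.size = 1 := rfl

@[simp] theorem size_node (l r : BinTree) : (node l r).size = l.size + r.size + 1 := by
  simp [size, code]

theorem one_le_size (t : BinTree) : 1 ≤ t.size := by
  cases t <;> simp

theorem length_code (t : BinTree) : t.code.length = t.size := rfl

/-- The prefix notation is self-delimiting. The arbitrary tails let the induction pass from the left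
subtree to the right one. -/
theorem code_append_inj {t t' : BinTree} {l l' : List Bool}
    (h : t.code ++ l = t'.code ++ l') : t = t' ∧ l = l' := by
  induction t generalizing t' l l' with
  | leaf =>
    cases t' with
    | leaf => exact ⟨rfl, by simpa [code] using h⟩
    | node _ _ => simp [code] at h
  | node t₁ t₂ ih₁ ih₂ =>
    cases t' with
    | leaf => simp [code] at h
    | node t₁' t₂' =>
      simp only [code, List.cons_append, List.append_assoc, List.cons.injEq, true_and] at h
      obtain ⟨rfl, h₂⟩ := ih₁ h
      obtain ⟨rfl, rfl⟩ := ih₂ h₂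
      exact ⟨rfl, rfl⟩

theorem code_injective : Function.Injective code := fun t t' h =>
  (code_append_inj (l := []) (l' := []) (by rw [h])).1

end BinTree

/-! ### Programs that move, copy and compare trees. -/

namespace StackMachine

/-- The store whose auxiliary stacks are empty. -/
abbrev clean (i : List InputSymbol) (o m : List Bool) : Store := store i o m [] [] []

namespace Prog

/-- Empty the stack `r` and run a program for each of its symbols. -/
def pour (r : Reg) (put : Sym r → Prog) : Prog :=
  node r (fun x => x.elim skip put) Option.isSome

/-- The store is described by the contents `l` of the stack being emptied and an abstract state `s`
of all the rest, on which a symbol acts by `eff`. Each symbol costs its pop and at most `k` further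
steps. -/
theorem runs_pour {X : Type} {r : Reg} {put : Sym r → Prog} (st : List (Sym r) → X → Store)
    (eff : X → Sym r → X) (k : ℕ) (hr : ∀ l s, st l s r = l)
    (hu : ∀ l s l', Function.update (st l s) r l' = st l' s)
    (hp : ∀ x l s, (put x).Runs (st l s) (st l (eff s x)) k) (l : List (Sym r)) (s : X) :
    (pour r put).Runs (st l s) (st [] (l.foldl eff s)) (l.length * (k + 1) + 1) := by
  induction l generalizing s with
  | nil =>
    exact (Runs.node_exit none (by simp [hr]) (by simpa [hr, hu] using runs_skip _) rfl).mono
      (by simp)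
  | cons x l ih =>
    refine (Runs.node_again (n := k) (some x) (by simp [hr]) ?_ rfl (ih (eff s x))).mono ?_
    · simpa [hr, hu] using hp x l s
    · simp only [List.length_cons]; linarith

theorem foldl_cons (l m : List Bool) : l.foldl (fun s x => x :: s) m = l.reverse ++ m := by
  induction l generalizing m with
  | nil => rfl
  | cons x l ih => simp [ih]

/-- The loop of `takeTree`: the stack `c` counts the trees that are still to be taken. -/
def takeLoop (put : Bool → Prog) : Prog :=
  node .c (fun x => x.elim skip fun _ => node .main
    (fun y => match y with
      | none => skip
      | some false => put false
      | some true => (put true).seq ((push .c true).seq (push .c true)))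
    fun _ => false) Option.isSome

/-- Take a tree from the main stack and run a program for each symbol of its code. -/
def takeTree (put : Bool → Prog) : Prog := (push .c true).seq (takeLoop put)

section take

variable {put : Bool → Prog} (st : List Bool → List Bool → List Bool → Store)
  (hm : ∀ d m c, st d m c .main = m) (hc : ∀ d m c, st d m c .c = c)
  (hum : ∀ d m c m', Function.update (st d m c) .main m' = st d m' c)
  (huc : ∀ d m c c', Function.update (st d m c) .c c' = st d m c')
  (hp : ∀ x d m c, (put x).Runs (st d m c) (st (x :: d) m c) 1)

include hm hc hum huc hp

/-- A leaf symbol completes one of the trees counted on `c`; a node symbol replaces one tree by two,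
hence the two pushes. The statement takes the run after the tree as a hypothesis, so that the
induction hypotheses for the two subtrees can be chained. -/
theorem runs_takeLoop (t : BinTree) (d m c : List Bool) (S : Store) (n : ℕ)
    (h : (takeLoop put).Runs (st (t.code.reverse ++ d) m c) S n) :
    (takeLoop put).Runs (st d (t.code ++ m) (true :: c)) S (n + 5 * t.size) := by
  induction t generalizing d m c n with
  | leaf =>
    refine (Runs.node_again (n := 2) (some true) (by simp [hc]) ?_ rfl h).mono (by simp; omega)
    simp only [Option.elim]
    refine Runs.node_exit (n := 1) (some false) (by simp [hc, hm, BinTree.code]) ?_ rfl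
    simpa [hc, huc, hm, hum, BinTree.code] using hp false d m c
  | node t₁ t₂ ih₁ ih₂ =>
    have h' := ih₁ (true :: d) (t₂.code ++ m) (true :: c) _ (ih₂ (t₁.code.reverse ++ true :: d) m c n
      (by simpa [BinTree.code] using h))
    refine (Runs.node_again (n := 4) (some true) (by simp [hc]) ?_ rfl h').mono (by simp; omega)
    simp only [Option.elim]
    refine Runs.node_exit (n := 3) (some true) (by simp [hc, hm, BinTree.code]) ?_ rfl
    have h1 := hp true d (t₁.code ++ (t₂.code ++ m)) c
    have h2 := runs_push .c true (st (true :: d) (t₁.code ++ (t₂.code ++ m)) c)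
    have h3 := runs_push .c true (st (true :: d) (t₁.code ++ (t₂.code ++ m)) (true :: c))
    simp only [hc, huc] at h2 h3
    simpa [hc, huc, hm, hum, BinTree.code] using h1.seq (h2.seq h3)

theorem runs_takeTree (t : BinTree) (d m : List Bool) :
    (takeTree put).Runs (st d (t.code ++ m) []) (st (t.code.reverse ++ d) m [])
      (5 * t.size + 2) := by
  have h1 := runs_push .c true (st d (t.code ++ m) [])
  simp only [hc, huc] at h1
  refine (h1.seq (runs_takeLoop st hm hc hum huc hp t d m [] _ 1 ?_)).mono (by omega)
  exact (Runs.node_exit none (by simp [hc]) (by simpa [hc, huc] using runs_skip _) rfl)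

end take

section tree

variable (i : List InputSymbol) (o m : List Bool)

theorem runs_takeA (t : BinTree) (a b : List Bool) :
    (takeTree (push .a)).Runs (store i o (t.code ++ m) a b [])
      (store i o m (t.code.reverse ++ a) b []) (5 * t.size + 2) :=
  runs_takeTree (fun d m c => store i o m d b c) (fun _ _ _ => rfl) (fun _ _ _ => rfl)
    (by simp) (by simp) (fun x d m c => by simpa using runs_push .a x (store i o m d b c)) t a m

theorem runs_takeB (t : BinTree) (a b : List Bool) :
    (takeTree (push .b)).Runs (store i o (t.code ++ m) a b [])
      (store i o m a (t.code.reverse ++ b) []) (5 * t.size + 2) :=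
  runs_takeTree (fun d m c => store i o m a d c) (fun _ _ _ => rfl) (fun _ _ _ => rfl)
    (by simp) (by simp) (fun x d m c => by simpa using runs_push .b x (store i o m a d c)) t b m

/-- Remove the tree on top of the main stack. -/
def drop : Prog := takeTree fun _ => skip

theorem runs_drop (t : BinTree) :
    drop.Runs (clean i o (t.code ++ m)) (clean i o m) (5 * t.size + 2) :=
  runs_takeTree (fun _ m c => store i o m [] [] c) (fun _ _ _ => rfl) (fun _ _ _ => rfl)
    (by simp) (by simp) (fun _ _ _ _ => (runs_skip _).mono zero_le_one) t [] m

theorem runs_pour_a (l b c : List Bool) :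
    (pour .a (push .main)).Runs (store i o m l b c) (store i o (l.reverse ++ m) [] b c)
      (2 * l.length + 1) := by
  have := runs_pour (r := .a) (put := push .main) (fun l m => store i o m l b c)
    (fun m x => x :: m) 1 (fun _ _ => rfl) (by simp)
    (fun x l m => by simpa using runs_push .main x (store i o m l b c)) l m
  rw [foldl_cons] at this
  exact this.mono (by omega)

theorem runs_pour_b (l a c : List Bool) :
    (pour .b (push .main)).Runs (store i o m a l c) (store i o (l.reverse ++ m) a [] c)
      (2 * l.length + 1) := by
  have := runs_pour (r := .b) (put := push .main) (fun l m => store i o m a l c)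
    (fun m x => x :: m) 1 (fun _ _ => rfl) (by simp)
    (fun x l m => by simpa using runs_push .main x (store i o m a l c)) l m
  rw [foldl_cons] at this
  exact this.mono (by omega)

/-- Exchange the two trees on top of the main stack. -/
def swap : Prog :=
  (takeTree (push .a)).seq ((takeTree (push .b)).seq
    ((pour .a (push .main)).seq (pour .b (push .main))))

theorem runs_swap (t t' : BinTree) :
    swap.Runs (clean i o (t.code ++ (t'.code ++ m))) (clean i o (t'.code ++ (t.code ++ m)))
      (7 * t.size + 7 * t'.size + 6) := by
  have h1 := runs_takeA i o (t'.code ++ m) t [] []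
  have h2 := runs_takeB i o m t' (t.code.reverse ++ []) []
  -- Taking a tree reverses its code and pouring reverses it again. The stack `a` is poured first,
  -- so `t'` ends on top.
  have h3 := runs_pour_a i o m (t.code.reverse ++ []) (t'.code.reverse ++ []) []
  have h4 := runs_pour_b i o ((t.code.reverse ++ []).reverse ++ m) (t'.code.reverse ++ []) [] []
  have := h1.seq (h2.seq (h3.seq h4))
  simp only [List.append_nil, List.reverse_reverse, List.length_reverse,
    BinTree.length_code] at this
  exact this.mono (by omega)

/-- Duplicate the tree on top of the main stack. -/
def dup : Prog :=
  (takeTree (push .a)).seq ((pour .a fun x => (push .main x).seq (push .b x)).seq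
    ((pour .b (push .a)).seq (pour .a (push .main))))

theorem runs_dup (t : BinTree) :
    dup.Runs (clean i o (t.code ++ m)) (clean i o (t.code ++ (t.code ++ m)))
      (12 * t.size + 5) := by
  have h1 := runs_takeA i o m t [] []
  have h2 := runs_pour (r := .a) (put := fun x => (push .main x).seq (push .b x))
    (fun l s => store i o (s ++ m) l s []) (fun s x => x :: s) 2 (fun _ _ => rfl) (by simp)
    (fun x l s => by
      have h := runs_push .main x (store i o (s ++ m) l s [])
      have h' := runs_push .b x (store i o (x :: s ++ m) l s [])
      simp only [update_store_main, store_main, update_store_b, store_b] at h h'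
      exact h.seq h') (t.code.reverse ++ []) []
  -- The copy on `b` is in the original order; it goes through `a` because pouring it directly would
  -- leave it reversed.
  have h3 := runs_pour (r := .b) (put := push .a)
    (fun l s => store i o (t.code ++ m) s l []) (fun s x => x :: s) 1 (fun _ _ => rfl) (by simp)
    (fun x l s => by simpa using (runs_push .a x (store i o (t.code ++ m) s l []))) t.code []
  have h4 := runs_pour_a i o (t.code ++ m) t.code.reverse [] []
  rw [foldl_cons] at h2 h3
  simp only [List.append_nil, List.reverse_reverse, List.nil_append, List.length_reverse,
    BinTree.length_code] at h1 h2 h3 h4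
  exact (h1.seq (h2.seq (h3.seq h4))).mono (by omega)

/-- Pop one symbol of the main stack and ignore it. -/
def popMain : Prog := node .main (fun _ => skip) fun _ => false

theorem runs_popMain (x : Bool) : popMain.Runs (clean i o (x :: m)) (clean i o m) 1 :=
  Runs.node_exit (some x) rfl (by simpa using runs_skip _) rfl

theorem runs_push_main (x : Bool) :
    (push .main x).Runs (clean i o m) (clean i o (x :: m)) 1 := by
  simpa using runs_push .main x (clean i o m)

/-- The effect of `compareLoop` on the stacks `b` and `c`. -/
def compareStep (s : List Bool × List Bool) (x : Bool) : List Bool × List Bool :=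
  (s.1.tail, if s.1.head? = some x then s.2 else true :: s.2)

/-- Compare the stacks `a` and `b`, and push a symbol on the stack `c` for each difference. -/
def compareLoop : Prog :=
  (pour .a fun x =>
    node .b (fun y => if y = some x then skip else push .c true) fun _ => false).seq
  (pour .b fun _ => push .c true)

theorem length_compare (l : List Bool) (s : List Bool × List Bool) :
    (l.foldl compareStep s).1.length ≤ s.1.length ∧
      (l.foldl compareStep s).2.length ≤ s.2.length + l.length := by
  induction l generalizing s with
  | nil => simp
  | cons x l ih =>
    obtain ⟨h1, h2⟩ := ih (compareStep s x)
    refine ⟨h1.trans (by simp [compareStep]), h2.trans ?_⟩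
    simp only [compareStep, List.length_cons]
    split_ifs
    · omega
    · rw [List.length_cons]; omega

/-- Marks in the second component are never removed, and an exhausted first component also gives a
mismatch. So the absence of both marks and remainder means equality. -/
theorem compare_eq_nil (l : List Bool) (s : List Bool × List Bool) :
    ((l.foldl compareStep s).1 = [] ∧ (l.foldl compareStep s).2 = []) ↔ s = (l, []) := by
  induction l generalizing s with
  | nil => simp [Prod.ext_iff]
  | cons x l ih =>
    rw [List.foldl_cons, ih]
    rcases s with ⟨_ | ⟨y, l'⟩, c⟩
    · simp [compareStep]
    · by_cases h : y = x <;> simp [compareStep, h]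

/-- Replace the two trees on top of the main stack by a tree that says if they are equal. -/
def eqTree : Prog :=
  (takeTree (push .a)).seq ((takeTree (push .b)).seq (compareLoop.seq
    (node .c (fun x => match x with
      | none => (push .main false).seq ((push .main false).seq (push .main true))
      | some _ => (pour .c fun _ => skip).seq (push .main false)) fun _ => false)))

theorem runs_eqTree (t t' : BinTree) [Decidable (t = t')] :
    eqTree.Runs (clean i o (t.code ++ (t'.code ++ m)))
      (clean i o ((if t = t' then BinTree.node .leaf .leaf else .leaf).code ++ m))
      (20 * t.size + 20 * t'.size + 20) := by
  have h1 := runs_takeA i o (t'.code ++ m) t [] []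
  have h2 := runs_takeB i o m t' (t.code.reverse ++ []) []
  have h3 := runs_pour (r := .a)
    (put := fun x => node .b (fun y => if y = some x then skip else push .c true) fun _ => false)
    (fun l (s : List Bool × List Bool) => store i o m l s.1 s.2) compareStep 2
    (fun _ _ => rfl) (by simp)
    (fun x l s => by
      refine Runs.node_exit (n := 1) s.1.head? rfl ?_ rfl
      by_cases h : s.1.head? = some x
      · simpa [h, compareStep] using (runs_skip _).mono zero_le_one
      · simpa [h, compareStep] using runs_push .c true (store i o m l s.1.tail s.2))
    t.code.reverse (t'.code.reverse, [])
  have hl := length_compare t.code.reverse (t'.code.reverse, [])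
  have hn := compare_eq_nil t.code.reverse (t'.code.reverse, [])
  generalize t.code.reverse.foldl compareStep (t'.code.reverse, []) = u at *
  have h4 := runs_pour (r := .b) (put := fun _ => push .c true)
    (fun l c => store i o m [] l c) (fun c _ => true :: c) 1
    (fun _ _ => rfl) (by simp)
    (fun x l s => by simpa using runs_push .c true (store i o m [] l s))
    u.1 u.2
  have hlen : (u.1.foldl (fun c _ => true :: c) u.2).length = u.1.length + u.2.length := by
    generalize u.2 = v
    generalize u.1 = w
    induction w generalizing v with
    | nil => simp
    | cons x w ih => rw [List.foldl_cons, ih]; simp only [List.length_cons]; omega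
  generalize u.1.foldl (fun c _ => true :: c) u.2 = w at *
  have heq : w = [] ↔ t = t' := by
    have : w = [] ↔ u.1 = [] ∧ u.2 = [] := by
      rw [← List.length_eq_zero_iff, hlen, Nat.add_eq_zero_iff, List.length_eq_zero_iff,
        List.length_eq_zero_iff]
    rw [this, hn]
    simp only [Prod.mk.injEq, and_true, List.reverse_inj]
    exact ⟨fun h => (BinTree.code_injective h).symm, fun h => by rw [h]⟩
  simp only [List.append_nil, List.length_reverse, List.length_nil, BinTree.length_code,
    zero_add] at h1 h2 h3 h4 hl
  refine (h1.seq (h2.seq ((h3.seq h4).seq (n' := w.length + 4) ?_))).mono (by omega)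
  cases w with
  | nil =>
    rw [if_pos (heq.1 rfl)]
    refine Runs.mono (n := 4) (Runs.node_exit none rfl ?_ rfl) (by simp)
    simpa [BinTree.code] using (runs_push_main i o m false).seq ((runs_push_main i o (false :: m) false).seq
      (runs_push_main i o (false :: false :: m) true))
  | cons x w =>
    rw [if_neg fun h => by simpa using heq.2 h]
    refine Runs.mono (Runs.node_exit (n := w.length + 2) (some x) rfl ?_ rfl) (by simp)
    have h5 := runs_pour (r := .c) (put := fun _ => skip)
      (fun l (_ : Unit) => store i o m [] [] l) (fun s _ => s) 0
      (fun _ _ => rfl) (by simp) (fun x l s => runs_skip _) w ()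
    simpa [BinTree.code] using (h5.seq (runs_push_main i o m false)).mono (by omega)

end tree

end Prog

end StackMachine

/-! ### Functions computable within a time bound -/

/-- An encoding of the elements of a type as binary trees. -/
class TreeCode (α : Type) where
  enc : α → BinTree

/-- Different elements have different codes. -/
class TreeCode.Faithful (α : Type) [TreeCode α] : Prop where
  inj : ∀ a b : α, enc a = enc b → a = b

open TreeCode (enc)

/-- The size of the code. -/
def codeSize {α : Type} [TreeCode α] (a : α) : ℕ := (enc a).size

section instances

variable {α β : Type} [TreeCode α] [TreeCode β]

instance : TreeCode Unit := ⟨fun _ => .leaf⟩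

instance : TreeCode Bool := ⟨fun b => bif b then .node .leaf .leaf else .leaf⟩

instance : TreeCode (α × β) := ⟨fun x => .node (enc x.1) (enc x.2)⟩

instance : TreeCode (List α) := ⟨fun l => l.foldr (fun a t => .node (enc a) t) .leaf⟩

instance : TreeCode ℕ := ⟨fun n => Nat.rec .leaf (fun _ t => .node .leaf t) n⟩

/-- The number of a symbol. -/
def InputSymbol.index : InputSymbol → ℕ
  | .zero => 0
  | .one => 1
  | .atom => 2
  | .neg => 3
  | .or => 4
  | .know => 5

instance : TreeCode InputSymbol := ⟨fun s => enc s.index⟩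

@[simp] theorem enc_pair (a : α) (b : β) : enc (a, b) = .node (enc a) (enc b) := rfl
@[simp] theorem enc_nil : enc ([] : List α) = .leaf := rfl
@[simp] theorem enc_cons (a : α) (l : List α) : enc (a :: l) = .node (enc a) (enc l) := rfl
@[simp] theorem enc_zero : enc 0 = .leaf := rfl
@[simp] theorem enc_succ (n : ℕ) : enc (n + 1) = .node .leaf (enc n) := rfl
@[simp] theorem enc_true : enc true = .node .leaf .leaf := rfl
@[simp] theorem enc_false : enc false = .leaf := rfl

instance [TreeCode.Faithful α] [TreeCode.Faithful β] : TreeCode.Faithful (α × β) where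
  inj a b h := by
    simp only [enc, BinTree.node.injEq] at h
    exact Prod.ext (TreeCode.Faithful.inj _ _ h.1) (TreeCode.Faithful.inj _ _ h.2)

instance [TreeCode.Faithful α] : TreeCode.Faithful (List α) where
  inj a b h := by
    induction a generalizing b with
    | nil => cases b <;> simp_all
    | cons x a ih =>
      cases b with
      | nil => simp at h
      | cons y b =>
        simp only [enc_cons, BinTree.node.injEq] at h
        rw [TreeCode.Faithful.inj _ _ h.1, ih _ h.2]

instance : TreeCode.Faithful ℕ where
  inj a b h := by
    induction a generalizing b with
    | zero => cases b <;> simp_all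
    | succ a ih =>
      cases b with
      | zero => simp at h
      | succ b =>
        simp only [enc_succ, BinTree.node.injEq, true_and] at h
        rw [ih _ h]

instance : TreeCode.Faithful InputSymbol where
  inj a b h := by
    have h' : a.index = b.index := TreeCode.Faithful.inj _ _ h
    cases a <;> cases b <;> first | rfl | exact absurd h' (by decide)

theorem one_le_codeSize (a : α) : 1 ≤ codeSize a := BinTree.one_le_size _

@[simp] theorem codeSize_pair (a : α) (b : β) :
    codeSize (a, b) = codeSize a + codeSize b + 1 := by
  simp [codeSize]

@[simp] theorem codeSize_nil : codeSize ([] : List α) = 1 := rfl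

@[simp] theorem codeSize_cons (a : α) (l : List α) :
    codeSize (a :: l) = codeSize a + codeSize l + 1 := by
  simp [codeSize]

@[simp] theorem codeSize_nat (n : ℕ) : codeSize n = 2 * n + 1 := by
  induction n with
  | zero => rfl
  | succ n ih =>
    have : codeSize (n + 1) = codeSize n + 2 := by simp [codeSize]; omega
    omega

theorem codeSize_bool_le (b : Bool) : codeSize b ≤ 3 := by
  cases b <;> simp [codeSize]

theorem codeSize_append (l l' : List α) :
    codeSize (l ++ l') + 1 = codeSize l + codeSize l' := by
  induction l with
  | nil => simp; omega
  | cons a l ih => simp; omega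

theorem length_lt_codeSize (l : List α) : l.length < codeSize l := by
  induction l with
  | nil => simp
  | cons a l ih => simp; omega

theorem codeSize_le_of_mem {a : α} {l : List α} (h : a ∈ l) : codeSize a < codeSize l := by
  induction l with
  | nil => simp at h
  | cons b l ih =>
    rcases List.mem_cons.1 h with rfl | h
    · simp only [codeSize_cons]; omega
    · have := ih h
      simp; omega

theorem codeSize_le_of_sublist {l l' : List α} (h : l.Sublist l') : codeSize l ≤ codeSize l' := by
  induction h with
  | slnil => rfl
  | cons a _ ih => simp; omega
  | cons_cons a _ ih => simp; omega

theorem codeSize_le_of_forall {l : List α} {M : ℕ} (h : ∀ a ∈ l, codeSize a ≤ M) :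
    codeSize l ≤ l.length * (M + 1) + 1 := by
  induction l with
  | nil => simp
  | cons a l ih =>
    have h1 := ih fun b hb => h b (List.mem_cons_of_mem _ hb)
    have h2 := h a List.mem_cons_self
    simp only [codeSize_cons, List.length_cons]
    linarith

end instances

open StackMachine

variable {α β γ σ : Type} [TreeCode α] [TreeCode β] [TreeCode γ] [TreeCode σ]

/-- The program replaces the code of `a` by the code of `f a` within `t a` steps. -/
def Computes (G : Prog) (f : α → β) (t : α → ℕ) : Prop :=
  ∀ a i o m, G.Runs (clean i o ((enc a).code ++ m)) (clean i o ((enc (f a)).code ++ m)) (t a)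

/-- Some program computes `f` in time `t`, which also bounds the size of the values. -/
def InTime (f : α → β) (t : α → ℕ) : Prop :=
  (∃ G, Computes G f t) ∧ ∀ a, codeSize (f a) ≤ t a

namespace InTime

theorem mono {f : α → β} {t u : α → ℕ} (h : InTime f t) (htu : ∀ a, t a ≤ u a) : InTime f u := by
  obtain ⟨⟨G, hG⟩, hs⟩ := h
  exact ⟨⟨G, fun a i o m => (hG a i o m).mono (htu a)⟩, fun a => (hs a).trans (htu a)⟩

theorem comp {f : α → β} {g : β → γ} {t : α → ℕ} {u : β → ℕ} (hg : InTime g u)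
    (hf : InTime f t) : InTime (fun a => g (f a)) fun a => t a + u (f a) := by
  obtain ⟨⟨F, hF⟩, -⟩ := hf
  obtain ⟨⟨G, hG⟩, hs⟩ := hg
  exact ⟨⟨F.seq G, fun a i o m => (hF a i o m).seq (hG (f a) i o m)⟩,
    fun a => (hs (f a)).trans (Nat.le_add_left _ _)⟩

/-- A change of type that preserves the code is free. Booleans as lists, numbers as lists of units,
and types or environments as pairs are all handled in this way. -/
theorem of_enc_eq {f : α → β} (h : ∀ a, enc (f a) = enc a) : InTime f codeSize :=
  ⟨⟨Prog.skip, fun a i o m => by rw [h]; exact (Prog.runs_skip _).mono (Nat.zero_le _)⟩,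
    fun a => by rw [codeSize, h]; rfl⟩

theorem pair {f : α → β} {g : α → γ} {t u : α → ℕ} (hf : InTime f t) (hg : InTime g u) :
    InTime (fun a => (f a, g a)) fun a => 8 * t a + 8 * u a + 19 * codeSize a + 12 := by
  obtain ⟨⟨F, hF⟩, hsf⟩ := hf
  obtain ⟨⟨G, hG⟩, hsg⟩ := hg
  refine ⟨⟨Prog.dup.seq (G.seq (Prog.swap.seq (F.seq (Prog.push .main true)))),
    fun a i o m => ?_⟩, fun a => ?_⟩
  · have h1 := Prog.runs_dup i o m (enc a)
    have h2 := hG a i o ((enc a).code ++ m)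
    have h3 := Prog.runs_swap i o m (enc (g a)) (enc a)
    have h4 := hF a i o ((enc (g a)).code ++ m)
    have h5 := Prog.runs_push_main i o ((enc (f a)).code ++ ((enc (g a)).code ++ m)) true
    have h6 : (enc (g a)).size ≤ u a := hsg a
    have := (h1.seq (h2.seq (h3.seq (h4.seq h5)))).mono
      (n' := 8 * t a + 8 * u a + 19 * codeSize a + 12) (by unfold codeSize; omega)
    simpa [BinTree.code] using this
  · have h1 := hsf a
    have h2 := hsg a
    simp only [codeSize_pair]
    omega

theorem fst : InTime (fun x : α × β => x.1) fun x => 13 * codeSize x + 9 := by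
  refine ⟨⟨Prog.popMain.seq (Prog.swap.seq Prog.drop), fun x i o m => ?_⟩, fun x => ?_⟩
  · have h1 := Prog.runs_popMain i o ((enc x.1).code ++ ((enc x.2).code ++ m)) true
    have h2 := Prog.runs_swap i o m (enc x.1) (enc x.2)
    have h3 := Prog.runs_drop i o ((enc x.1).code ++ m) (enc x.2)
    have := (h1.seq (h2.seq h3)).mono (n' := 13 * codeSize x + 9)
      (by rw [codeSize_pair]; unfold codeSize; omega)
    simpa [enc, BinTree.code] using this
  · obtain ⟨x, y⟩ := x
    simp only [codeSize_pair]; omega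

theorem snd : InTime (fun x : α × β => x.2) fun x => 13 * codeSize x + 9 := by
  refine ⟨⟨Prog.popMain.seq Prog.drop, fun x i o m => ?_⟩, fun x => ?_⟩
  · have h1 := Prog.runs_popMain i o ((enc x.1).code ++ ((enc x.2).code ++ m)) true
    have h2 := Prog.runs_drop i o ((enc x.2).code ++ m) (enc x.1)
    have := (h1.seq h2).mono (n' := 13 * codeSize x + 9)
      (by rw [codeSize_pair]; unfold codeSize; omega)
    simpa [enc, BinTree.code] using this
  · obtain ⟨x, y⟩ := x
    simp only [codeSize_pair]; omega

/-- The factor `codeSize a` is there because the argument has to be erased; as it is at least 1, it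
also absorbs the cost of writing `b`. -/
theorem const (b : β) : ∃ k, InTime (fun _ : α => b) fun a => k * codeSize a := by
  have key : ∀ t : BinTree, ∃ k, (∃ G : Prog, ∀ (a : α) i o m,
      G.Runs (clean i o ((enc a).code ++ m)) (clean i o (t.code ++ m)) (k * codeSize a)) ∧
      t.size ≤ k := by
    intro t
    induction t with
    | leaf =>
      refine ⟨8, ⟨Prog.drop.seq (Prog.push .main false), fun a i o m => ?_⟩, by simp⟩
      have := one_le_codeSize a
      exact ((Prog.runs_drop i o m (enc a)).seq (Prog.runs_push_main i o m false)).mono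
        (by unfold codeSize at *; omega)
    | node l r hl hr =>
      obtain ⟨k, ⟨F, hF⟩, hk⟩ := hl
      obtain ⟨k', ⟨G, hG⟩, hk'⟩ := hr
      refine ⟨k + 8 * k' + 31, ⟨Prog.dup.seq (G.seq (Prog.swap.seq (F.seq (Prog.push .main true)))),
        fun a i o m => ?_⟩, by simp; omega⟩
      have h1 := Prog.runs_dup i o m (enc a)
      have h2 := hG a i o ((enc a).code ++ m)
      have h3 := Prog.runs_swap i o m r (enc a)
      have h4 := hF a i o (r.code ++ m)
      have h5 := Prog.runs_push_main i o (l.code ++ (r.code ++ m)) true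
      have h0 := one_le_codeSize a
      have := (h1.seq (h2.seq (h3.seq (h4.seq h5)))).mono
        (n' := (k + 8 * k' + 31) * codeSize a) (by unfold codeSize at *; nlinarith)
      simpa [BinTree.code] using this
  obtain ⟨k, hG, hk⟩ := key (enc b)
  exact ⟨k, hG, fun a => hk.trans (Nat.le_mul_of_pos_right _ (one_le_codeSize a))⟩

theorem listCases {l : α → List β} {g : α → γ} {h : α × β × List β → γ} {t u : α → ℕ}
    {v : α × β × List β → ℕ} (hl : InTime l t) (hg : InTime g u) (hh : InTime h v) :
    InTime (fun a => List.casesOn (motive := fun _ => γ) (l a) (g a) fun b l' => h (a, b, l')) fun a =>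
      19 * codeSize a + 8 * t a + 20 + u a +
        List.casesOn (motive := fun _ => ℕ) (l a) 0 fun b l' => v (a, b, l') := by
  obtain ⟨⟨L, hL⟩, hsl⟩ := hl
  obtain ⟨⟨G, hG⟩, hsg⟩ := hg
  obtain ⟨⟨H, hH⟩, hsh⟩ := hh
  refine ⟨⟨Prog.dup.seq (L.seq (Prog.node .main (fun x => match x with
    | some true => (Prog.push .main true).seq (Prog.swap.seq ((Prog.push .main true).seq H))
    | _ => G) fun _ => false)), fun a i o m => ?_⟩, fun a => ?_⟩
  · have h1 := Prog.runs_dup i o m (enc a)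
    have h2 := hL a i o ((enc a).code ++ m)
    have h3 := hsl a
    dsimp only
    rcases hla : l a with _ | ⟨b, l'⟩
    · rw [hla] at h2
      refine (h1.seq (h2.seq (Prog.Runs.node_exit (n := u a) (some false) rfl ?_ rfl))).mono
        (by unfold codeSize at *; omega)
      simpa [BinTree.code] using hG a i o m
    · rw [hla] at h2 h3
      refine (h1.seq (h2.seq (Prog.Runs.node_exit
        (n := 1 + (7 * codeSize (b, l') + 7 * codeSize a + 6 + (1 + v (a, b, l'))))
        (some true) rfl ?_ rfl))).mono (by simp only [codeSize, enc_cons, enc_pair, BinTree.size_node] at *; omega)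
      -- The symbol that was tested headed the code of `b :: l'`. Putting it back makes the pair
      -- `(b, l')`; exchanging this with `a` and pushing a node symbol gives the argument of `h`.
      have h4 := Prog.runs_push_main i o ((enc b).code ++ ((enc l').code ++ ((enc a).code ++ m))) true
      have h5 := Prog.runs_swap i o m (enc (b, l')) (enc a)
      have h6 := Prog.runs_push_main i o ((enc a).code ++ ((enc (b, l')).code ++ m)) true
      have h7 := hH (a, b, l') i o m
      simp only [enc_pair, BinTree.code, List.cons_append, List.append_assoc] at h4 h5 h6 h7
      have := h4.seq (h5.seq (h6.seq h7))
      simpa [BinTree.code, codeSize] using this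
  · dsimp only
    rcases l a with _ | ⟨b, l'⟩
    · exact (hsg a).trans (by omega)
    · exact (hsh (a, b, l')).trans (Nat.le_add_left _ _)

theorem eq [TreeCode.Faithful β] [DecidableEq β] :
    InTime (fun x : β × β => decide (x.1 = x.2)) fun x => 20 * codeSize x + 21 := by
  refine ⟨⟨Prog.popMain.seq Prog.eqTree, fun x i o m => ?_⟩,
    fun x => (codeSize_bool_le _).trans (by change 3 ≤ _ + 21; omega)⟩
  classical
  have h1 := Prog.runs_popMain i o ((enc x.1).code ++ ((enc x.2).code ++ m)) true
  have h2 := Prog.runs_eqTree i o m (enc x.1) (enc x.2)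
  have := (h1.seq h2).mono (n' := 20 * codeSize x + 21)
      (by rw [codeSize_pair]; unfold codeSize; omega)
  have h3 : enc x.1 = enc x.2 ↔ x.1 = x.2 := ⟨TreeCode.Faithful.inj _ _, fun h => by rw [h]⟩
  have h4 : (if enc x.1 = enc x.2 then BinTree.node .leaf .leaf else .leaf) =
      enc (decide (x.1 = x.2)) := by
    by_cases h : x.1 = x.2 <;> simp [h3, h]
  rw [h4] at this
  simpa [enc, BinTree.code] using this

end InTime

/-! ### Polynomial time and its closure properties. -/

/-- `f` is computable in time polynomial in the size of the code of the argument. -/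
@[fun_prop]
def PolyTime (f : α → β) : Prop :=
  ∃ p : Polynomial ℕ, InTime f fun a => p.eval (codeSize a)

theorem Polynomial.eval_mono_nat (p : Polynomial ℕ) {a b : ℕ} (h : a ≤ b) :
    p.eval a ≤ p.eval b := by
  rw [Polynomial.eval_eq_sum_range, Polynomial.eval_eq_sum_range]
  exact Finset.sum_le_sum fun i _ => Nat.mul_le_mul_left _ (Nat.pow_le_pow_left h i)

/-- The loop of a left fold. The main stack holds the code of the rest of the list and the code of
the pair of the accumulated value and the parameter. -/
def foldLoop (G : Prog) : Prog :=
  Prog.node .main (fun x => match x with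
    | some true => (Prog.push .main true).seq ((Prog.push .main true).seq (G.seq Prog.popMain))
    | _ => Prog.skip) fun x => x == some true

theorem runs_foldLoop {h : α → σ → β → σ} {G : Prog} {p : Polynomial ℕ}
    (hG : Computes G (fun x : (β × List β) × (σ × α) => (x.1.2, (h x.2.2 x.2.1 x.1.1, x.2.2)))
      fun x => p.eval (codeSize x)) (a : α) (B : ℕ) (i o m) (l : List β) (s : σ)
    (hB : ∀ l', l' <+: l → codeSize (l'.foldl (h a) s) ≤ B) :
    (foldLoop G).Runs (clean i o ((enc l).code ++ ((enc (s, a)).code ++ m)))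
      (clean i o ((enc (l.foldl (h a) s, a)).code ++ m))
      (l.length * (p.eval (codeSize l + B + codeSize a + 5) + 5) + 2) := by
  induction l generalizing s with
  | nil =>
    refine (Prog.Runs.node_exit (n := 0) (some false) rfl ?_ rfl).mono (by omega)
    simpa [BinTree.code] using Prog.runs_skip _
  | cons b l ih =>
    have ih := ih (h a s b) fun l' hl' => hB (b :: l') (by simpa using hl')
    have hs : codeSize s ≤ B := hB [] (List.nil_prefix)
    -- Two node symbols join the three codes on the stack to `((b, l), (s, a))`. After the body, one
    -- pop splits the resulting pair, which restores the invariant of the loop.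
    have h1 := Prog.runs_push_main i o
      ((enc b).code ++ ((enc l).code ++ ((enc (s, a)).code ++ m))) true
    have h2 := Prog.runs_push_main i o
      ((enc (b, l)).code ++ ((enc (s, a)).code ++ m)) true
    have h3 := hG ((b, l), (s, a)) i o m
    have h4 := Prog.runs_popMain i o
      ((enc l).code ++ ((enc (h a s b, a)).code ++ m)) true
    simp only [enc_pair, BinTree.code, List.cons_append, List.append_assoc] at h1 h2 h3 h4
    have h5 := h1.seq (h2.seq (h3.seq h4))
    refine (Prog.Runs.node_again (some true) rfl ?_ rfl ih).mono
      (n := 1 + (1 + (p.eval (codeSize ((b, l), (s, a))) + 1)) + 1 +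
        (l.length * (p.eval (codeSize l + B + codeSize a + 5) + 5) + 2)) ?_
    · simpa [BinTree.code] using h5
    · have e1 : p.eval (codeSize ((b, l), (s, a))) ≤
          p.eval (codeSize (b :: l) + B + codeSize a + 5) :=
        p.eval_mono_nat (by simp only [codeSize_pair, codeSize_cons]; omega)
      have e2 : p.eval (codeSize l + B + codeSize a + 5) ≤
          p.eval (codeSize (b :: l) + B + codeSize a + 5) :=
        p.eval_mono_nat (by simp only [codeSize_cons]; omega)
      simp only [List.length_cons]
      nlinarith [Nat.mul_le_mul_left l.length e2]

namespace PolyTime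

theorem of_inTime {f : α → β} {t : α → ℕ} (h : InTime f t) (p : Polynomial ℕ)
    (hp : ∀ a, t a ≤ p.eval (codeSize a)) : PolyTime f :=
  ⟨p, h.mono hp⟩

theorem exists_codeSize_le {f : α → β} (h : PolyTime f) :
    ∃ p : Polynomial ℕ, ∀ a, codeSize (f a) ≤ p.eval (codeSize a) := by
  obtain ⟨p, h⟩ := h
  exact ⟨p, h.2⟩

theorem of_enc_eq {f : α → β} (h : ∀ a, enc (f a) = enc a) : PolyTime f :=
  of_inTime (InTime.of_enc_eq h) Polynomial.X (by simp)

@[fun_prop]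
theorem id : PolyTime fun a : α => a :=
  of_enc_eq fun _ => rfl

@[fun_prop]
theorem comp {f : α → β} {g : β → γ} (hg : PolyTime g) (hf : PolyTime f) :
    PolyTime fun a => g (f a) := by
  obtain ⟨p, hf⟩ := hf
  obtain ⟨q, hg⟩ := hg
  refine of_inTime (hg.comp hf) (p + q.comp p) fun a => ?_
  simp only [Polynomial.eval_add, Polynomial.eval_comp]
  exact Nat.add_le_add_left (q.eval_mono_nat (hf.2 a)) _

@[fun_prop]
theorem pair {f : α → β} {g : α → γ} (hf : PolyTime f) (hg : PolyTime g) :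
    PolyTime fun a => (f a, g a) := by
  obtain ⟨p, hf⟩ := hf
  obtain ⟨q, hg⟩ := hg
  exact of_inTime (hf.pair hg) (8 * p + 8 * q + 19 * Polynomial.X + 12) (by simp)

theorem fst : PolyTime fun x : α × β => x.1 :=
  of_inTime InTime.fst (13 * Polynomial.X + 9) (by simp)

theorem snd : PolyTime fun x : α × β => x.2 :=
  of_inTime InTime.snd (13 * Polynomial.X + 9) (by simp)

@[fun_prop]
theorem comp_fst {f : α → β × γ} (hf : PolyTime f) : PolyTime fun a => (f a).1 := fst.comp hf

@[fun_prop]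
theorem comp_snd {f : α → β × γ} (hf : PolyTime f) : PolyTime fun a => (f a).2 := snd.comp hf

@[fun_prop]
theorem const (b : β) : PolyTime fun _ : α => b := by
  obtain ⟨k, h⟩ := InTime.const (α := α) b
  exact of_inTime h (Polynomial.C k * Polynomial.X) (by simp)

theorem listCases {l : α → List β} {g : α → γ} {h : α → β → List β → γ} (hl : PolyTime l)
    (hg : PolyTime g) (hh : PolyTime fun x : α × β × List β => h x.1 x.2.1 x.2.2) :
    PolyTime fun a => List.casesOn (motive := fun _ => γ) (l a) (g a) fun b l' => h a b l' := by
  obtain ⟨p, hl⟩ := hl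
  obtain ⟨q, hg⟩ := hg
  obtain ⟨r, hh⟩ := hh
  refine of_inTime (hl.listCases hg hh)
    (19 * Polynomial.X + 8 * p + 20 + q + r.comp (Polynomial.X + p + 1)) fun a => ?_
  have h1 : codeSize (l a) ≤ p.eval (codeSize a) := hl.2 a
  cases hla : l a with
  | nil => simp
  | cons b l' =>
    rw [hla, codeSize_cons] at h1
    have : r.eval (codeSize (a, b, l')) ≤ r.eval (codeSize a + p.eval (codeSize a) + 1) :=
      r.eval_mono_nat (by simp only [codeSize_pair]; omega)
    simpa using this

@[fun_prop]
theorem eq [TreeCode.Faithful β] [DecidableEq β] {f g : α → β} (hf : PolyTime f)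
    (hg : PolyTime g) : PolyTime fun a => decide (f a = g a) :=
  (of_inTime InTime.eq (20 * Polynomial.X + 21) (by simp)).comp (hf.pair hg)

end PolyTime

/-- Iterating a polynomial-time body may blow up the accumulated value, so a bound `B` on all
intermediate values is required. The polynomial is chosen before `B`; this allows an exponential `B`
in `towerTime_sublists'`. -/
theorem InTime.foldl {l : α → List β} {g : α → σ} {h : α → σ → β → σ} {t u : α → ℕ}
    (hl : InTime l t) (hg : InTime g u)
    (hh : PolyTime fun x : α × σ × β => h x.1 x.2.1 x.2.2) :
    ∃ p : Polynomial ℕ, ∀ B : α → ℕ,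
      (∀ a l', l' <+: l a → codeSize (l'.foldl (h a) (g a)) ≤ B a) →
      InTime (fun a => (l a).foldl (h a) (g a))
        fun a => p.eval (t a + u a + codeSize a + B a) := by
  have hbody : PolyTime fun x : (β × List β) × (σ × α) =>
      (x.1.2, (h x.2.2 x.2.1 x.1.1, x.2.2)) := by
    refine (PolyTime.comp_snd (PolyTime.comp_fst PolyTime.id)).pair (PolyTime.pair ?_ ?_)
    · exact hh.comp (f := fun x : (β × List β) × (σ × α) => (x.2.2, x.2.1, x.1.1)) (by fun_prop)
    · fun_prop
  obtain ⟨q, ⟨G, hG⟩, -⟩ := hbody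
  -- The linear part generously covers pairing and projecting; the product bounds the number of
  -- rounds times the cost of one round.
  refine ⟨400 * Polynomial.X + 400 +
    Polynomial.X * (q.comp (Polynomial.X + 5) + 5), fun B hB => ?_⟩
  have hpair := hl.pair (hg.pair (InTime.of_enc_eq (f := fun a : α => a) fun _ => rfl))
  obtain ⟨⟨F, hF⟩, -⟩ := hpair
  have hB' : ∀ a, codeSize ((l a).foldl (h a) (g a)) ≤ B a := fun a => hB a _ (List.prefix_refl _)
  have key : InTime (fun a => ((l a).foldl (h a) (g a), a)) fun a =>
      (8 * t a + 8 * (8 * u a + 8 * codeSize a + 19 * codeSize a + 12) + 19 * codeSize a + 12) +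
        (1 + ((l a).length * (q.eval (codeSize (l a) + B a + codeSize a + 5) + 5) + 2)) + B a := by
    refine ⟨⟨F.seq (Prog.popMain.seq (foldLoop G)), fun a i o m => ?_⟩, fun a => ?_⟩
    · have h1 := hF a i o m
      have h2 := Prog.runs_popMain i o ((enc (l a)).code ++ ((enc (g a, a)).code ++ m)) true
      have h3 := runs_foldLoop hG a (B a) i o m (l a) (g a) (hB a)
      refine (Prog.Runs.seq h1 (Prog.Runs.seq ?_ h3)).mono (Nat.le_add_right _ _)
      simpa [BinTree.code] using h2
    · have := hB' a
      simp only [codeSize_pair]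
      omega
  refine (InTime.fst.comp key).mono fun a => ?_
  have h1 := hl.2 a
  have h2 := hB' a
  have h3 := length_lt_codeSize (l a)
  have h4 : q.eval (codeSize (l a) + B a + codeSize a + 5) ≤
      q.eval (t a + u a + codeSize a + B a + 5) := q.eval_mono_nat (by omega)
  have h5 : (l a).length * (q.eval (codeSize (l a) + B a + codeSize a + 5) + 5) ≤
      (t a + u a + codeSize a + B a) * (q.eval (t a + u a + codeSize a + B a + 5) + 5) :=
    Nat.mul_le_mul (by omega) (by omega)
  simp only [codeSize_pair, Polynomial.eval_add, Polynomial.eval_mul, Polynomial.eval_X,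
    Polynomial.eval_comp, Polynomial.eval_ofNat]
  omega

namespace PolyTime

theorem foldl {l : α → List β} {g : α → σ} {h : α → σ → β → σ} (hl : PolyTime l)
    (hg : PolyTime g) (hh : PolyTime fun x : α × σ × β => h x.1 x.2.1 x.2.2)
    (B : Polynomial ℕ)
    (hB : ∀ a l', l' <+: l a → codeSize (l'.foldl (h a) (g a)) ≤ B.eval (codeSize a)) :
    PolyTime fun a => (l a).foldl (h a) (g a) := by
  obtain ⟨p, hl⟩ := hl
  obtain ⟨q, hg⟩ := hg
  obtain ⟨r, hr⟩ := hl.foldl hg hh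
  exact of_inTime (hr (fun a => B.eval (codeSize a)) hB) (r.comp (p + q + Polynomial.X + B))
    (by simp [Polynomial.eval_comp])

@[fun_prop]
theorem cons {f : α → β} {g : α → List β} (hf : PolyTime f) (hg : PolyTime g) :
    PolyTime fun a => f a :: g a :=
  (of_enc_eq (f := fun x : β × List β => x.1 :: x.2) fun _ => rfl).comp (hf.pair hg)

@[fun_prop]
theorem cond {c : α → Bool} {f g : α → β} (hc : PolyTime c) (hf : PolyTime f)
    (hg : PolyTime g) : PolyTime fun a => bif c a then f a else g a := by
  -- The codes of `true` and `false` are those of `[()]` and `[]`, so a conditional is a case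
  -- distinction on a list.
  have h1 : PolyTime fun b : Bool => bif b then [()] else [] :=
    of_enc_eq fun b => by cases b <;> rfl
  have := listCases (l := fun a => bif c a then [()] else []) (h := fun a _ _ => f a)
    (h1.comp hc) hg (hf.comp fst)
  convert this using 2 with a
  cases c a <;> rfl

@[fun_prop]
theorem not {c : α → Bool} (hc : PolyTime c) : PolyTime fun a => !c a := by
  convert hc.cond (const false) (const true) using 2 with a
  cases c a <;> rfl

@[fun_prop]
theorem and {c d : α → Bool} (hc : PolyTime c) (hd : PolyTime d) :
    PolyTime fun a => c a && d a := by
  convert hc.cond hd (const false) using 2 with a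
  cases c a <;> rfl

@[fun_prop]
theorem or {c d : α → Bool} (hc : PolyTime c) (hd : PolyTime d) :
    PolyTime fun a => c a || d a := by
  convert hc.cond (const true) hd using 2 with a
  cases c a <;> rfl

@[fun_prop]
theorem tail {l : α → List β} (hl : PolyTime l) : PolyTime fun a => (l a).tail := by
  convert listCases (g := fun _ => []) (h := fun _ _ l' => l') hl (by fun_prop) (by fun_prop)
    using 2 with a
  cases l a <;> rfl

@[fun_prop]
theorem headD {l : α → List β} {d : α → β} (hl : PolyTime l) (hd : PolyTime d) :
    PolyTime fun a => (l a).headD (d a) := by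
  convert listCases (g := d) (h := fun _ b _ => b) hl (by fun_prop) (by fun_prop) using 2 with a
  cases l a <;> rfl

@[fun_prop]
theorem reverse {l : α → List β} (hl : PolyTime l) : PolyTime fun a => (l a).reverse := by
  obtain ⟨p, hp⟩ := hl.exists_codeSize_le
  have key : ∀ l m : List β, l.foldl (fun s b => b :: s) m = l.reverse ++ m := fun l => by
    induction l with
    | nil => simp
    | cons b l ih => simp [ih]
  have hrev : ∀ l : List β, codeSize l.reverse = codeSize l := fun l => by
    induction l with
    | nil => rfl
    | cons b l ih =>
      have := codeSize_append l.reverse [b]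
      simp only [List.reverse_cons, codeSize_cons, codeSize_nil] at *
      omega
  have := foldl (g := fun _ => []) (h := fun _ s b => b :: s) hl (by fun_prop) (by fun_prop) p
    fun a l' hl' => by
      rw [key, List.append_nil, hrev]
      exact (codeSize_le_of_sublist hl'.sublist).trans (hp a)
  simpa [key] using this

/-- A right fold is a left fold over the reversed list, so the size bound is now about suffixes. -/
theorem foldr {l : α → List β} {g : α → σ} {h : α → β → σ → σ} (hl : PolyTime l)
    (hg : PolyTime g) (hh : PolyTime fun x : α × β × σ => h x.1 x.2.1 x.2.2)
    (B : Polynomial ℕ)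
    (hB : ∀ a l', l' <:+ l a → codeSize (l'.foldr (h a) (g a)) ≤ B.eval (codeSize a)) :
    PolyTime fun a => (l a).foldr (h a) (g a) := by
  have := foldl (h := fun a s b => h a b s) hl.reverse hg
    (hh.comp (f := fun x : α × σ × β => (x.1, x.2.2, x.2.1)) (by fun_prop)) B fun a l' hl' => by
      have := hB a l'.reverse (by simpa using List.reverse_suffix.2 hl')
      simpa using this
  simpa using this

@[fun_prop]
theorem append {l l' : α → List β} (hl : PolyTime l) (hl' : PolyTime l') :
    PolyTime fun a => l a ++ l' a := by
  obtain ⟨p, hp⟩ := hl.exists_codeSize_le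
  obtain ⟨q, hq⟩ := hl'.exists_codeSize_le
  have key : ∀ l l' : List β, l.foldr (fun b s => b :: s) l' = l ++ l' := fun l l' => by
    induction l with
    | nil => simp
    | cons b l ih => simp [ih]
  have := foldr (h := fun _ b s => b :: s) hl hl' (by fun_prop) (p + q) fun a k hk => by
      rw [key, Polynomial.eval_add]
      have h1 := codeSize_append k (l' a)
      have h2 := codeSize_le_of_sublist hk.sublist
      have h3 := hp a
      have h4 := hq a
      omega
  simpa only [key] using this

theorem map {l : α → List β} {f : α → β → γ} (hl : PolyTime l)
    (hf : PolyTime fun x : α × β => f x.1 x.2) : PolyTime fun a => (l a).map (f a) := by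
  obtain ⟨p, hp⟩ := hl.exists_codeSize_le
  obtain ⟨q, hq⟩ := hf.exists_codeSize_le
  have key : ∀ a (l : List β), l.foldr (fun b s => f a b :: s) [] = l.map (f a) := fun a l => by
    induction l with
    | nil => simp
    | cons b l ih => simp [ih]
  have := foldr (g := fun _ => []) (h := fun a b s => f a b :: s) hl (by fun_prop)
    (by
      refine cons ?_ (by fun_prop)
      exact hf.comp (f := fun x : α × β × List γ => (x.1, x.2.1)) (by fun_prop))
    (p * (q.comp (Polynomial.X + p + 1) + 1) + 1) fun a k hk => by
      rw [key]
      refine (codeSize_le_of_forall (M := q.eval (codeSize a + p.eval (codeSize a) + 1))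
        fun c hc => ?_).trans ?_
      · obtain ⟨b, hb, rfl⟩ := List.mem_map.1 hc
        refine (hq (a, b)).trans (q.eval_mono_nat ?_)
        have h1 := codeSize_le_of_mem (hk.subset hb)
        have h2 := hp a
        simp only [codeSize_pair]
        omega
      · have h1 := length_lt_codeSize k
        have h2 := codeSize_le_of_sublist hk.sublist
        have h3 := hp a
        simp only [List.length_map, Polynomial.eval_add, Polynomial.eval_mul, Polynomial.eval_comp,
          Polynomial.eval_X, Polynomial.eval_one]
        gcongr
        omega
  simpa only [key] using this

theorem flatMap {l : α → List β} {f : α → β → List γ} (hl : PolyTime l)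
    (hf : PolyTime fun x : α × β => f x.1 x.2) : PolyTime fun a => (l a).flatMap (f a) := by
  obtain ⟨p, hp⟩ := hl.exists_codeSize_le
  obtain ⟨q, hq⟩ := hf.exists_codeSize_le
  have key : ∀ a (l : List β), l.foldr (fun b s => f a b ++ s) [] = l.flatMap (f a) :=
    fun a l => by
      induction l with
      | nil => simp
      | cons b l ih => simp [ih]
  have := foldr (g := fun _ => []) (h := fun a b s => f a b ++ s) hl (by fun_prop)
    (by
      refine append ?_ (by fun_prop)
      exact hf.comp (f := fun x : α × β × List γ => (x.1, x.2.1)) (by fun_prop))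
    (p * q.comp (Polynomial.X + p + 1) + 1) fun a k hk => by
      rw [key]
      have h2 := codeSize_le_of_sublist hk.sublist
      have h3 := hp a
      have h4 : ∀ b ∈ k, codeSize (f a b) ≤ q.eval (codeSize a + p.eval (codeSize a) + 1) :=
        fun b hb => (hq (a, b)).trans <| q.eval_mono_nat <| by
          have h1 := codeSize_le_of_mem (hk.subset hb)
          simp only [codeSize_pair]
          omega
      have h5 : codeSize (k.flatMap (f a)) ≤
          k.length * q.eval (codeSize a + p.eval (codeSize a) + 1) + 1 := by
        clear hk h2
        induction k with
        | nil => simp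
        | cons b k ih =>
          have h6 := ih fun b hb => h4 b (List.mem_cons_of_mem _ hb)
          have h7 := codeSize_append (f a b) (k.flatMap (f a))
          have h8 := h4 b List.mem_cons_self
          simp only [List.flatMap_cons, List.length_cons]
          linarith
      refine h5.trans ?_
      have h1 := length_lt_codeSize k
      simp only [Polynomial.eval_add, Polynomial.eval_mul, Polynomial.eval_comp,
        Polynomial.eval_X, Polynomial.eval_one]
      gcongr
      omega
  simpa only [key] using this

theorem filter {l : α → List β} {f : α → β → Bool} (hl : PolyTime l)
    (hf : PolyTime fun x : α × β => f x.1 x.2) : PolyTime fun a => (l a).filter (f a) := by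
  have := hl.flatMap (f := fun a b => bif f a b then [b] else []) (by fun_prop)
  convert this using 2 with a
  induction l a with
  | nil => rfl
  | cons b l ih => cases h : f a b <;> simp [h, ih]

theorem any {l : α → List β} {f : α → β → Bool} (hl : PolyTime l)
    (hf : PolyTime fun x : α × β => f x.1 x.2) : PolyTime fun a => (l a).any (f a) := by
  have := ((hl.filter hf).map (f := fun _ _ => true) (by fun_prop)).headD (const false)
  convert this using 2 with a
  induction l a with
  | nil => rfl
  | cons b l ih => cases h : f a b <;> simp [h, ih]

theorem all {l : α → List β} {f : α → β → Bool} (hl : PolyTime l)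
    (hf : PolyTime fun x : α × β => f x.1 x.2) : PolyTime fun a => (l a).all (f a) := by
  have := (hl.any (f := fun a b => !f a b) (by fun_prop)).not
  convert this using 2 with a
  rw [List.all_eq_not_any_not]

end PolyTime

/-! ### Recursion on lists, arithmetic and indexing in polynomial time. -/

namespace PolyTime

/-- Primitive recursion, in which a step also sees the tail: the fold rebuilds the tail next to the
value. -/
theorem listRec {l : α → List β} {g : α → σ} {h : α → β → List β → σ → σ} (hl : PolyTime l)
    (hg : PolyTime g) (hh : PolyTime fun x : α × β × List β × σ => h x.1 x.2.1 x.2.2.1 x.2.2.2)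
    {f : α → List β → σ} (hnil : ∀ a, f a [] = g a)
    (hcons : ∀ a b l, f a (b :: l) = h a b l (f a l)) (B : Polynomial ℕ)
    (hB : ∀ a l', l' <:+ l a → codeSize (f a l') ≤ B.eval (codeSize a)) :
    PolyTime fun a => f a (l a) := by
  obtain ⟨p, hp⟩ := hl.exists_codeSize_le
  have key : ∀ a (l : List β),
      l.foldr (fun b (s : List β × σ) => (b :: s.1, h a b s.1 s.2)) ([], g a) = (l, f a l) := by
    intro a l
    induction l with
    | nil => simp [hnil]
    | cons b l ih => simp [ih, hcons]
  have := foldr (g := fun a => (([] : List β), g a))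
    (h := fun a b (s : List β × σ) => (b :: s.1, h a b s.1 s.2)) hl
    (by fun_prop)
    (by
      refine pair (by fun_prop) ?_
      exact hh.comp (f := fun x : α × β × List β × σ => (x.1, x.2.1, x.2.2.1, x.2.2.2))
        (by fun_prop)) (p + B + 1) fun a k hk => by
      rw [key]
      have h1 := codeSize_le_of_sublist hk.sublist
      have h2 := hp a
      have h3 := hB a k hk
      simp only [codeSize_pair, Polynomial.eval_add, Polynomial.eval_one]
      omega
  simp only [key] at this
  exact this.comp_snd

@[fun_prop]
theorem succ {f : α → ℕ} (hf : PolyTime f) : PolyTime fun a => f a + 1 :=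
  (of_enc_eq (f := fun x : Unit × ℕ => x.2 + 1) fun _ => rfl).comp ((const ()).pair hf)

/-- Numbers are coded in unary exactly as lists of units, so arithmetic reduces to list operations.
-/
theorem enc_replicate_unit (n : ℕ) : enc (List.replicate n ()) = enc n := by
  induction n with
  | zero => rfl
  | succ n ih => rw [List.replicate_succ, enc_cons, ih]; rfl

@[fun_prop]
theorem replicate {f : α → ℕ} {g : α → β} (hf : PolyTime f) (hg : PolyTime g) :
    PolyTime fun a => List.replicate (f a) (g a) := by
  have h1 : PolyTime fun n : ℕ => List.replicate n () := of_enc_eq enc_replicate_unit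
  have := (h1.comp hf).map (f := fun a _ => g a) (by fun_prop)
  simpa using this

@[fun_prop]
theorem length {l : α → List β} (hl : PolyTime l) : PolyTime fun a => (l a).length := by
  have h1 : PolyTime fun l : List Unit => l.length :=
    of_enc_eq fun l => by
      rw [← enc_replicate_unit, ← List.eq_replicate_of_mem (l := l) (a := ()) (by simp)]
  have := h1.comp (hl.map (f := fun _ _ => ()) (by fun_prop))
  simpa using this

@[fun_prop]
theorem add {f g : α → ℕ} (hf : PolyTime f) (hg : PolyTime g) : PolyTime fun a => f a + g a := by
  have := ((hf.replicate (const ())).append (hg.replicate (const ()))).length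
  simpa using this

@[fun_prop]
theorem mul {f g : α → ℕ} (hf : PolyTime f) (hg : PolyTime g) : PolyTime fun a => f a * g a := by
  have := ((hf.replicate (const ())).flatMap (f := fun a _ => List.replicate (g a) ())
    (by fun_prop)).length
  simpa using this

@[fun_prop]
theorem range {f : α → ℕ} (hf : PolyTime f) : PolyTime fun a => List.range (f a) := by
  obtain ⟨p, hp⟩ := hf.exists_codeSize_le
  have key : ∀ n : ℕ, (List.replicate n ()).foldl
      (fun (s : List ℕ) _ => s ++ [s.length]) [] = List.range n := fun n => by
    induction n with
    | zero => rfl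
    | succ n ih =>
      rw [List.replicate_succ', List.foldl_append, ih, List.range_succ]
      simp
  have := foldl (l := fun a => List.replicate (f a) ()) (g := fun _ => [])
    (h := fun _ (s : List ℕ) _ => s ++ [s.length]) (by fun_prop) (by fun_prop) (by fun_prop)
    (p * (2 * p + 2) + 1) fun a k hk => by
      obtain ⟨j, hj, rfl⟩ : ∃ j ≤ f a, k = List.replicate j () :=
        ⟨k.length, by simpa using hk.length_le, List.eq_replicate_of_mem (by simp)⟩
      rw [key]
      have h1 := hp a
      rw [codeSize_nat] at h1
      refine (codeSize_le_of_forall (M := 2 * p.eval (codeSize a) + 1) fun i hi => ?_).trans ?_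
      · rw [codeSize_nat]
        have := List.mem_range.1 hi
        omega
      · simp only [List.length_range, Polynomial.eval_add, Polynomial.eval_mul,
          Polynomial.eval_ofNat, Polynomial.eval_one]
        gcongr ?_ * ?_ + 1
        · omega
        · omega
  simpa only [key] using this

@[fun_prop]
theorem drop {f : α → ℕ} {l : α → List β} (hf : PolyTime f) (hl : PolyTime l) :
    PolyTime fun a => (l a).drop (f a) := by
  obtain ⟨p, hp⟩ := hl.exists_codeSize_le
  have key : ∀ (k : List Unit) (l : List β), k.foldl (fun s _ => s.tail) l = l.drop k.length :=
    fun k => by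
      induction k with
      | nil => simp
      | cons u k ih => simp [ih]
  have := foldl (l := fun a => List.replicate (f a) ()) (g := l)
    (h := fun _ (s : List β) _ => s.tail) (by fun_prop) hl (by fun_prop) p fun a k hk => by
      rw [key]
      exact (codeSize_le_of_sublist (List.drop_sublist _ _)).trans (hp a)
  simpa only [key, List.length_replicate] using this

@[fun_prop]
theorem getD {l : α → List β} {f : α → ℕ} {d : α → β} (hl : PolyTime l) (hf : PolyTime f)
    (hd : PolyTime d) : PolyTime fun a => (l a).getD (f a) (d a) := by
  have := (hf.drop hl).headD hd
  convert this using 2 with a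
  rw [List.getD_eq_getElem?_getD, List.headD_eq_head?_getD, List.head?_drop]

@[fun_prop]
theorem mem [TreeCode.Faithful β] [DecidableEq β] {l : α → List β} {f : α → β}
    (hl : PolyTime l) (hf : PolyTime f) : PolyTime fun a => decide (f a ∈ l a) := by
  have := hl.any (f := fun a b => decide (b = f a)) (by fun_prop)
  convert this using 2 with a
  induction l a with
  | nil => rfl
  | cons b l ih => simp [← ih, eq_comm, Bool.decide_or]

theorem idxOf [TreeCode.Faithful β] [DecidableEq β] {l : α → List β} {f : α → β}
    (hl : PolyTime l) (hf : PolyTime f) : PolyTime fun a => (l a).idxOf (f a) := by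
  obtain ⟨p, hp⟩ := hl.exists_codeSize_le
  refine listRec (g := fun _ => 0) (h := fun a b _ n => bif decide (b = f a) then 0 else n + 1) hl
    (by fun_prop) (by fun_prop) (f := fun a l => l.idxOf (f a)) (fun a => rfl)
    (fun a b l => ?_) (2 * p + 1) fun a k hk => ?_
  · by_cases h : b = f a <;> simp [h]
  · have h1 := codeSize_le_of_sublist hk.sublist
    have h2 := length_lt_codeSize k
    have h3 := hp a
    have h4 := List.idxOf_le_length (a := f a) (l := k)
    simp only [codeSize_nat, Polynomial.eval_add, Polynomial.eval_mul,
          Polynomial.eval_ofNat, Polynomial.eval_one]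
    omega

end PolyTime

/-! ### Iterated exponential bounds -/

theorem expTower_mono (j : ℕ) {a b : ℕ} (h : a ≤ b) : expTower j a ≤ expTower j b := by
  induction j with
  | zero => exact h
  | succ j ih => exact Nat.pow_le_pow_right (by norm_num) ih

theorem le_expTower (j n : ℕ) : n ≤ expTower j n := by
  induction j with
  | zero => exact le_rfl
  | succ j ih => exact ih.trans Nat.lt_two_pow_self.le

theorem expTower_add (i j n : ℕ) : expTower (i + j) n = expTower i (expTower j n) := by
  induction i with
  | zero => rw [Nat.zero_add]; rfl
  | succ i ih => rw [Nat.succ_add]; exact congrArg _ ih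

/-- For x ≥ 1 every monomial is at most its coefficient times x to the degree of `p`, so p(x) ≤ p(1)
x^deg. -/
theorem Polynomial.eval_two_pow_le (p : Polynomial ℕ) :
    ∃ q : Polynomial ℕ, ∀ n, p.eval (2 ^ n) ≤ 2 ^ q.eval n := by
  refine ⟨Polynomial.C (p.eval 1) + Polynomial.C p.natDegree * Polynomial.X, fun n => ?_⟩
  have h1 : p.eval (2 ^ n) ≤ p.eval 1 * (2 ^ n) ^ p.natDegree := by
    rw [Polynomial.eval_eq_sum_range, Polynomial.eval_eq_sum_range, Finset.sum_mul]
    refine Finset.sum_le_sum fun i hi => ?_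
    rw [one_pow, mul_one]
    exact Nat.mul_le_mul_left _ (Nat.pow_le_pow_right (Nat.two_pow_pos n)
      (Finset.mem_range_succ_iff.1 hi))
  refine h1.trans ?_
  simp only [Polynomial.eval_add, Polynomial.eval_mul, Polynomial.eval_C, Polynomial.eval_X]
  rw [pow_add, ← pow_mul, mul_comm n]
  exact Nat.mul_le_mul_right _ Nat.lt_two_pow_self.le

/-- A polynomial applied outside a tower can be pushed down through the exponentials, one at a time,
into the polynomial at the bottom. This makes the time classes robust under polynomial overhead. -/
theorem Polynomial.eval_expTower_le (q p : Polynomial ℕ) (j : ℕ) :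
    ∃ r : Polynomial ℕ, ∀ n, q.eval (expTower j (p.eval n)) ≤ expTower j (r.eval n) := by
  induction j generalizing q with
  | zero => exact ⟨q.comp p, fun n => by simp [expTower, Polynomial.eval_comp]⟩
  | succ j ih =>
    obtain ⟨q', hq'⟩ := q.eval_two_pow_le
    obtain ⟨r, hr⟩ := ih q'
    exact ⟨r, fun n => (hq' _).trans (Nat.pow_le_pow_right (by norm_num) (hr n))⟩

/-- `f` is computable in time `j`-fold exponential in a polynomial of the size of the code of the
argument. -/
def TowerTime (j : ℕ) (f : α → β) : Prop :=
  ∃ p : Polynomial ℕ, InTime f fun a => expTower j (p.eval (codeSize a))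

theorem PolyTime.towerTime {f : α → β} (h : PolyTime f) (j : ℕ) : TowerTime j f := by
  obtain ⟨p, h⟩ := h
  exact ⟨p, h.mono fun a => le_expTower _ _⟩

/-- Heights add, because the second function runs on a value whose size may already be a tower of
height `j`. Polynomial-time functions have height 0 and cost nothing. -/
theorem TowerTime.comp {i j : ℕ} {f : α → β} {g : β → γ} (hg : TowerTime i g)
    (hf : TowerTime j f) : TowerTime (i + j) fun a => g (f a) := by
  obtain ⟨p, hf⟩ := hf
  obtain ⟨q, hg⟩ := hg
  obtain ⟨r, hr⟩ := q.eval_expTower_le p j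
  -- The factor 2 merges the running times of `f` and `g`, both bounded by the same tower.
  obtain ⟨s, hs⟩ := (2 * Polynomial.X : Polynomial ℕ).eval_expTower_le (p + r) (i + j)
  refine ⟨s, (hg.comp hf).mono fun a => (le_trans ?_ (hs _))⟩
  have h1 : expTower j (p.eval (codeSize a)) ≤ expTower (i + j) ((p + r).eval (codeSize a)) := by
    rw [expTower_add]
    exact (le_expTower i _).trans (expTower_mono _ (expTower_mono _ (by simp)))
  have h2 : expTower i (q.eval (codeSize (f a))) ≤
      expTower (i + j) ((p + r).eval (codeSize a)) := by
    rw [expTower_add]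
    refine expTower_mono _ ((q.eval_mono_nat (hf.2 a)).trans ((hr _).trans (expTower_mono _ ?_)))
    simp
  simp only [Polynomial.eval_mul, Polynomial.eval_X, Polynomial.eval_ofNat]
  omega

theorem TowerTime.pair {j : ℕ} {f : α → β} {g : α → γ} (hf : TowerTime j f)
    (hg : TowerTime j g) : TowerTime j fun a => (f a, g a) := by
  obtain ⟨p, hf⟩ := hf
  obtain ⟨q, hg⟩ := hg
  obtain ⟨r, hr⟩ := (35 * Polynomial.X + 12 : Polynomial ℕ).eval_expTower_le
    (p + q + Polynomial.X) j
  refine ⟨r, (hf.pair hg).mono fun a => (le_trans ?_ (hr _))⟩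
  have h1 : expTower j (p.eval (codeSize a)) ≤
      expTower j ((p + q + Polynomial.X).eval (codeSize a)) := expTower_mono _ (by simp; omega)
  have h2 : expTower j (q.eval (codeSize a)) ≤
      expTower j ((p + q + Polynomial.X).eval (codeSize a)) := expTower_mono _ (by simp; omega)
  have h3 : codeSize a ≤ expTower j ((p + q + Polynomial.X).eval (codeSize a)) :=
    le_trans (by simp) (le_expTower _ _)
  simp only [Polynomial.eval_add, Polynomial.eval_mul, Polynomial.eval_X, Polynomial.eval_ofNat]
    at h1 h2 h3 ⊢
  omega

theorem codeSize_sublists'_le (l : List β) : codeSize l.sublists' ≤ 2 ^ (2 * codeSize l + 1) := by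
  refine (codeSize_le_of_forall (M := codeSize l) fun k hk =>
    codeSize_le_of_sublist (List.mem_sublists'.1 hk)).trans ?_
  rw [List.length_sublists']
  have h1 : 2 ^ l.length ≤ 2 ^ codeSize l :=
    Nat.pow_le_pow_right (by norm_num) (length_lt_codeSize l).le
  have h2 : codeSize l + 1 ≤ 2 ^ codeSize l := Nat.lt_two_pow_self
  have h3 : 1 ≤ 2 ^ codeSize l := Nat.one_le_two_pow
  rw [pow_succ, two_mul, pow_add]
  nlinarith [Nat.mul_le_mul h1 h2]

/-- The fold doubles its value with each element, so its body is polynomial and its intermediate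
values have an exponential bound. All exponential growth in the construction comes from here. -/
theorem towerTime_sublists' : TowerTime 1 fun l : List β => l.sublists' := by
  have key : ∀ l : List β, l.reverse.foldl (fun (s : List (List β)) b =>
      s ++ s.map fun k => b :: k) [[]] = l.sublists' := fun l => by
    induction l with
    | nil => rfl
    | cons b l ih =>
      rw [List.reverse_cons, List.foldl_append, ih, List.sublists'_cons]
      rfl
  obtain ⟨p, hp⟩ : PolyTime fun l : List β => l.reverse := by fun_prop
  obtain ⟨q, hq⟩ : PolyTime fun _ : List β => ([[]] : List (List β)) := PolyTime.const _
  obtain ⟨r, hr⟩ := hp.foldl hq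
    (h := fun _ (s : List (List β)) b => s ++ s.map fun k => b :: k)
    (PolyTime.append (by fun_prop) (PolyTime.map (by fun_prop) (by fun_prop)))
  have := hr (fun l => 2 ^ (2 * codeSize l + 1)) fun l k hk => by
    rw [← List.reverse_reverse k, key]
    refine (codeSize_sublists'_le _).trans (Nat.pow_le_pow_right (by norm_num) ?_)
    have h1 : k.reverse.Sublist l := by
      simpa using (List.reverse_sublist.2 hk.sublist)
    have := codeSize_le_of_sublist h1
    omega
  simp only [key] at this
  obtain ⟨s, hs⟩ := (r.comp (2 * Polynomial.X)).eval_expTower_le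
    (p + q + 3 * Polynomial.X + 1) 1
  refine ⟨s, this.mono fun l => le_trans ?_ (hs _)⟩
  simp only [Polynomial.eval_comp, Polynomial.eval_add, Polynomial.eval_mul, Polynomial.eval_X,
    Polynomial.eval_ofNat, Polynomial.eval_one, expTower]
  refine r.eval_mono_nat ?_
  generalize p.eval (codeSize l) = x
  generalize q.eval (codeSize l) = y
  generalize codeSize l = n
  have h1 : x + y + n < 2 ^ (x + y + n) := Nat.lt_two_pow_self
  have h2 : 2 ^ (x + y + n) ≤ 2 ^ (x + y + 3 * n + 1) :=
    Nat.pow_le_pow_right (by norm_num) (by omega)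
  have h3 : 2 ^ (2 * n + 1) ≤ 2 ^ (x + y + 3 * n + 1) :=
    Nat.pow_le_pow_right (by norm_num) (by omega)
  generalize 2 ^ (x + y + n) = A at *
  generalize 2 ^ (2 * n + 1) = B at *
  generalize 2 ^ (x + y + 3 * n + 1) = C at *
  omega

/-! ### From time bounds for functions on words to Turing machines -/

namespace StackMachine

namespace Prog

/-- Put a word on the main stack. -/
def pushWord : List Bool → Prog
  | [] => skip
  | b :: l => (pushWord l).seq (push .main b)

theorem runs_pushWord (i : List InputSymbol) (o m l : List Bool) :
    (pushWord l).Runs (clean i o m) (clean i o (l ++ m)) l.length := by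
  induction l with
  | nil => exact runs_skip _
  | cons b l ih => exact ih.seq (runs_push_main i o (l ++ m) b)

/-- Read the input, and put the code of its reversal on the main stack. -/
def readInput : Prog :=
  (push .main false).seq (pour .inp fun s => (pushWord (enc s).code).seq (push .main true))

theorem codeSize_inputSymbol_le (s : InputSymbol) : codeSize s ≤ 11 := by
  cases s <;> decide

theorem runs_readInput (w : List InputSymbol) :
    readInput.Runs (clean w [] []) (clean [] [] ((enc w.reverse).code ++ []))
      (13 * w.length + 2) := by
  have h1 := runs_push_main w [] [] false
  have h2 := runs_pour (r := .inp)
    (put := fun s => (pushWord (enc s).code).seq (push .main true))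
    (fun l m => clean l [] m) (fun m s => true :: ((enc s).code ++ m)) 12 (fun _ _ => rfl)
    (by simp)
    (fun s l m => ((runs_pushWord l [] m (enc s).code).seq
      (runs_push_main l [] ((enc s).code ++ m) true)).mono
        (by have := codeSize_inputSymbol_le s; unfold codeSize BinTree.size at this; omega))
    w [false]
  have key : ∀ (w k : List InputSymbol), w.foldl (fun m s => true :: ((enc s).code ++ m))
      (enc k).code = (enc (w.reverse ++ k)).code := fun w => by
    induction w with
    | nil => simp
    | cons s w ih =>
      intro k
      have := ih (s :: k)
      simpa [BinTree.code] using this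
  have h3 := key w []
  rw [List.append_nil] at h3
  rw [List.append_nil, ← h3]
  exact (h1.seq h2).mono (by omega)

/-- Move the list of Boolean values on the main stack to the output stack. -/
def writeOutput : Prog :=
  node .main (fun x => match x with
    | some true => node .main (fun y => match y with
      | some true => popMain.seq (popMain.seq (push .out true))
      | _ => push .out false) fun _ => false
    | _ => skip) fun x => x == some true

theorem runs_writeOutput (i : List InputSymbol) (l o : List Bool) :
    writeOutput.Runs (clean i o (enc l).code) (clean i (l.reverse ++ o) []) (5 * l.length + 1) := by
  induction l generalizing o with
  | nil =>
    refine (Prog.Runs.node_exit (n := 0) (some false) rfl ?_ rfl).mono (by omega)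
    simpa [BinTree.code] using Prog.runs_skip _
  | cons b l ih =>
    have h := ih (b :: o)
    refine (Prog.Runs.node_again (n := 4) (S' := clean i (b :: o) (enc l).code) (some true) rfl ?_
      rfl (by rw [List.reverse_cons, List.append_assoc]; exact h)).mono (by simp; omega)
    cases b with
    | true =>
      refine Prog.Runs.node_exit (n := 3) (some true) rfl ?_ rfl
      have h1 := runs_popMain i o (false :: (enc l).code) false
      have h2 := runs_popMain i o (enc l).code false
      have h3 := runs_push .out true (clean i o (enc l).code)
      simp only [update_store_out, store_out] at h3
      simpa [BinTree.code] using h1.seq (h2.seq h3)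
    | false =>
      refine (Prog.Runs.node_exit (n := 1) (some false) rfl ?_ rfl).mono (by omega)
      have h3 := runs_push .out false (clean i o (enc l).code)
      simp only [update_store_out, store_out] at h3
      simpa [BinTree.code] using h3

end Prog

end StackMachine

/-- Reading the input from its stack and writing the output each reverse a word, which is undone by
conjugating `F` with reversals. The polynomial `q` converts bounds in the length of the word into
bounds in the size of the instance. -/
theorem TowerTime.computableInExpTime {ι : Type} {j : ℕ}
    {F : List InputSymbol → List Bool} (hF : TowerTime (j + 1) F) {e : ι → List InputSymbol}
    {size : ι → ℕ} (q : Polynomial ℕ) (hq : ∀ a, (e a).length ≤ q.eval (size a)) :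
    ComputableInExpTime (j + 1) e size fun a => F (e a) := by
  have h1 : TowerTime (0 + ((j + 1) + 0)) fun w : List InputSymbol => (F w.reverse).reverse :=
    ((PolyTime.id (α := List Bool)).reverse.towerTime 0).comp
      (hF.comp ((PolyTime.id (α := List InputSymbol)).reverse.towerTime 0))
  rw [Nat.zero_add, Nat.add_zero] at h1
  obtain ⟨p, ⟨G, hG⟩, hs⟩ := h1
  obtain ⟨r, hr⟩ := (7 * Polynomial.X + 13 * Polynomial.X + 10 : Polynomial ℕ).eval_expTower_le
    (p.comp (12 * q + 1) + q) (j + 1)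
  let P : Prog := Prog.readInput.seq (G.seq Prog.writeOutput)
  refine ⟨⟨P.toTM (.inl (.inl ())), Equiv.refl _, Equiv.refl _⟩, r, fun a => ?_⟩
  have hrun : P.Runs (clean (e a) [] []) (clean [] (F (e a)) [])
      (expTower (j + 1) (r.eval (size a))) := by
    have e1 := Prog.runs_readInput (e a)
    have e2 := hG (e a).reverse [] [] []
    have e3 := Prog.runs_writeOutput [] (F (e a)).reverse []
    rw [List.append_nil, List.reverse_reverse] at e3
    simp only [List.reverse_reverse, List.append_nil] at e1 e2
    refine (e1.seq (e2.seq e3)).mono ((le_trans ?_ (hr (size a))))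
    -- A symbol has a code of size at most 11, and each list cell adds 1; the final 1 is the empty
    -- list.
    have l1 : codeSize (e a).reverse ≤ 12 * q.eval (size a) + 1 := by
      refine (codeSize_le_of_forall (M := 11) fun s _ => Prog.codeSize_inputSymbol_le s).trans ?_
      have := hq a
      rw [List.length_reverse]
      omega
    have l2 : expTower (j + 1) (p.eval (codeSize (e a).reverse)) ≤
        expTower (j + 1) ((p.comp (12 * q + 1) + q).eval (size a)) := by
      refine expTower_mono _ ((p.eval_mono_nat l1).trans ?_)
      simp [Polynomial.eval_comp]
    have l3 : (F (e a)).reverse.length ≤ expTower (j + 1) (p.eval (codeSize (e a).reverse)) := by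
      have := hs (e a).reverse
      simp only [List.reverse_reverse] at this
      exact (length_lt_codeSize _).le.trans this
    have l4 : (e a).length ≤ expTower (j + 1) ((p.comp (12 * q + 1) + q).eval (size a)) := by
      refine (hq a).trans (le_trans ?_ (le_expTower _ _))
      simp
    simp only [Polynomial.eval_add, Polynomial.eval_mul, Polynomial.eval_X, Polynomial.eval_ofNat]
    simp only [Polynomial.eval_add] at l2 l4
    omega
  obtain ⟨n, hn, h⟩ := Prog.toTM_iterate P (.inl (.inl ())) (.inl (.inl ())) none _ _ _ hrun
  refine ⟨⟨⟨n, ?_⟩, hn⟩⟩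
  have hi : Turing.initList (P.toTM (.inl (.inl ())))
      ((e a).map (Equiv.refl InputSymbol).invFun) =
      ⟨some (.inl (.inl ())), none, clean (e a) [] []⟩ := by
    unfold Turing.initList
    congr 1
    funext k
    cases k <;> first | rfl | exact List.map_id _
  have ho : Turing.haltList (P.toTM (.inl (.inl ())))
      ((F (e a)).map (Equiv.refl Bool).invFun) = ⟨none, none, clean [] (F (e a)) []⟩ := by
    unfold Turing.haltList
    congr 1
    funext k
    cases k <;> first | rfl | exact List.map_id _
  exact (congrArg (fun c => (flip bind (P.toTM (.inl (.inl ()))).step)^[n] (some c)) hi).trans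
    (h.trans (congrArg some ho.symm))

/-! ### Types of pointed models

The type of depth `d` of a pointed epistemic model consists of the atoms that are true at the point
and, if `d > 0`, of the sets of types of depth `d - 1` of the successors of the point. -/

/-- Types of depth `d`. -/
def Ty : ℕ → Type
  | 0 => List ℕ
  | d + 1 => List ℕ × List (List (Ty d))

namespace Ty

instance decEq : ∀ d, DecidableEq (Ty d)
  | 0 => inferInstanceAs (DecidableEq (List ℕ))
  | d + 1 =>
    haveI := decEq d
    inferInstanceAs (DecidableEq (List ℕ × List (List (Ty d))))

instance treeCode : ∀ d, TreeCode (Ty d)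
  | 0 => inferInstanceAs (TreeCode (List ℕ))
  | d + 1 =>
    haveI := treeCode d
    inferInstanceAs (TreeCode (List ℕ × List (List (Ty d))))

instance faithful : ∀ d, TreeCode.Faithful (Ty d)
  | 0 => inferInstanceAs (TreeCode.Faithful (List ℕ))
  | d + 1 =>
    haveI := faithful d
    inferInstanceAs (TreeCode.Faithful (List ℕ × List (List (Ty d))))

/-- The type of depth zero with the given true atoms. -/
def ofVal (v : List ℕ) : Ty 0 := v

/-- The type with the given true atoms and successors. -/
def mk {d : ℕ} (v : List ℕ) (ss : List (List (Ty d))) : Ty (d + 1) := (v, ss)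

/-- The true atoms. -/
def val : ∀ {d : ℕ}, Ty d → List ℕ
  | 0, t => t
  | _ + 1, t => Prod.fst (α := List ℕ) t

/-- The successors, for each agent. -/
def succs {d : ℕ} (t : Ty (d + 1)) : List (List (Ty d)) := Prod.snd (α := List ℕ) t

@[simp] theorem val_mk {d : ℕ} (v : List ℕ) (ss : List (List (Ty d))) : (mk v ss).val = v := rfl
@[simp] theorem succs_mk {d : ℕ} (v : List ℕ) (ss : List (List (Ty d))) :
    (mk v ss).succs = ss := rfl

@[fun_prop]
theorem polyTime_ofVal {f : α → List ℕ} (hf : PolyTime f) : PolyTime fun a => ofVal (f a) :=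
  (PolyTime.of_enc_eq (f := ofVal) fun _ => rfl).comp hf

@[fun_prop]
theorem polyTime_mk {d : ℕ} {f : α → List ℕ} {g : α → List (List (Ty d))} (hf : PolyTime f)
    (hg : PolyTime g) : PolyTime fun a => mk (f a) (g a) :=
  (PolyTime.of_enc_eq (f := fun x : List ℕ × List (List (Ty d)) => mk x.1 x.2) fun _ => rfl).comp
    (hf.pair hg)

@[fun_prop]
theorem polyTime_val {d : ℕ} {f : α → Ty d} (hf : PolyTime f) : PolyTime fun a => (f a).val := by
  cases d with
  | zero => exact (PolyTime.of_enc_eq (f := fun t : Ty 0 => t.val) fun _ => rfl).comp hf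
  | succ d =>
    have h : PolyTime fun t : Ty (d + 1) => ((t.val, t.succs) : List ℕ × List (List (Ty d))) :=
      PolyTime.of_enc_eq fun _ => rfl
    exact h.comp_fst.comp hf

@[fun_prop]
theorem polyTime_succs {d : ℕ} {f : α → Ty (d + 1)} (hf : PolyTime f) :
    PolyTime fun a => (f a).succs := by
  have h : PolyTime fun t : Ty (d + 1) => ((t.val, t.succs) : List ℕ × List (List (Ty d))) :=
    PolyTime.of_enc_eq fun _ => rfl
  exact h.comp_snd.comp hf

end Ty

/-! ### Evaluation of formulas in a word

A word that contains formulas in prefix notation is read from right to left. The symbols for zero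
and one that do not belong to a formula are collected. -/

/-- Read a number in unary. -/
def readUnary : List Bool → ℕ × List Bool
  | [] => (0, [])
  | true :: l => ((readUnary l).1 + 1, (readUnary l).2)
  | false :: l => (0, l)

theorem readUnary_size (l : List Bool) :
    (readUnary l).1 ≤ l.length ∧ (readUnary l).2.length ≤ l.length := by
  induction l with
  | nil => simp [readUnary]
  | cons b l ih => cases b <;> simp only [readUnary, List.length_cons] <;> omega

@[fun_prop]
theorem PolyTime.readUnary {f : α → List Bool} (hf : PolyTime f) :
    PolyTime fun a => _root_.readUnary (f a) := by
  obtain ⟨p, hp⟩ := hf.exists_codeSize_le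
  refine PolyTime.listRec (g := fun _ => (0, []))
    (h := fun _ b l r => bif b then (r.1 + 1, r.2) else (0, l)) hf (by fun_prop) (by fun_prop)
    (f := fun _ l => _root_.readUnary l) (fun _ => rfl) (fun _ b l => by cases b <;> rfl)
    (6 * p + 2) fun a k hk => ?_
  have h1 := readUnary_size k
  have h2 := codeSize_le_of_forall (l := (_root_.readUnary k).2) (M := 3)
    fun b _ => codeSize_bool_le b
  have h3 := length_lt_codeSize k
  have h4 := codeSize_le_of_sublist hk.sublist
  have h5 := hp a
  have h6 := codeSize_pair (_root_.readUnary k).1 (_root_.readUnary k).2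
  rw [Prod.mk.eta, codeSize_nat] at h6
  simp only [Polynomial.eval_add, Polynomial.eval_mul, Polynomial.eval_ofNat]
  omega

/-- The effect of one symbol on the collected bits and the stack of truth values. The list `v`
contains the true atoms, and `K` is used for the modalities. -/
def evalStep (v : List ℕ) (K : ℕ → Bool) (s : InputSymbol) (r : List Bool × List Bool) :
    List Bool × List Bool :=
  match s with
  | .zero => (false :: r.1, r.2)
  | .one => (true :: r.1, r.2)
  | .atom => ((readUnary r.1).2, decide ((readUnary r.1).1 ∈ v) :: r.2)
  | .neg => (r.1, (!r.2.headD false) :: r.2.tail)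
  | .or => (r.1, (r.2.headD false || r.2.tail.headD false) :: r.2.tail.tail)
  | .know => ((readUnary r.1).2, K (readUnary r.1).1 :: r.2.tail)

theorem PolyTime.evalStep {v : α → List ℕ} {K : α → ℕ → Bool} {s : α → InputSymbol}
    {r : α → List Bool × List Bool} (hv : PolyTime v)
    (hK : PolyTime fun x : α × ℕ => K x.1 x.2) (hs : PolyTime s) (hr : PolyTime r) :
    PolyTime fun a => _root_.evalStep (v a) (K a) (s a) (r a) := by
  have hK' : PolyTime fun a => K a (_root_.readUnary (r a).1).1 :=
    hK.comp (f := fun a => (a, (_root_.readUnary (r a).1).1)) (by fun_prop)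
  have : PolyTime fun a =>
      bif decide (s a = .zero) then (false :: (r a).1, (r a).2)
      else bif decide (s a = .one) then (true :: (r a).1, (r a).2)
      else bif decide (s a = .atom) then ((_root_.readUnary (r a).1).2,
        decide ((_root_.readUnary (r a).1).1 ∈ v a) :: (r a).2)
      else bif decide (s a = .neg) then ((r a).1, (!(r a).2.headD false) :: (r a).2.tail)
      else bif decide (s a = .or) then
        ((r a).1, ((r a).2.headD false || (r a).2.tail.headD false) :: (r a).2.tail.tail)
      else ((_root_.readUnary (r a).1).2, K a (_root_.readUnary (r a).1).1 :: (r a).2.tail) := by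
    fun_prop
  convert this using 2 with a
  cases s a <;> rfl

/-- The collected bits and the stack of the truth values of formulas in a type. -/
def evalWord : ∀ {d : ℕ}, Ty d → List InputSymbol → List Bool × List Bool
  | _, _, [] => ([], [])
  | 0, t, s :: w => evalStep t.val (fun _ => false) s (evalWord t w)
  | _ + 1, t, s :: w =>
    evalStep t.val (fun i => (t.succs.getD i []).all fun t' => (evalWord t' w).2.headD false) s
      (evalWord t w)

theorem evalWord_nil {d : ℕ} (t : Ty d) : evalWord t [] = ([], []) := by
  cases d <;> rfl

theorem length_evalStep (v : List ℕ) (K : ℕ → Bool) (s : InputSymbol) (r : List Bool × List Bool) :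
    (evalStep v K s r).1.length + (evalStep v K s r).2.length ≤ r.1.length + r.2.length + 1 := by
  have := readUnary_size r.1
  cases s <;> simp [evalStep] <;> omega

theorem length_evalWord {d : ℕ} (t : Ty d) (w : List InputSymbol) :
    (evalWord t w).1.length + (evalWord t w).2.length ≤ w.length := by
  induction w with
  | nil => rw [evalWord_nil]; simp
  | cons s w ih =>
    cases d <;> exact (length_evalStep _ _ _ _).trans (Nat.succ_le_succ ih)

theorem codeSize_evalWord_le {d : ℕ} (t : Ty d) (w : List InputSymbol) :
    codeSize (evalWord t w) ≤ 4 * codeSize w + 3 := by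
  have h1 := length_evalWord t w
  have h2 := codeSize_le_of_forall (l := (evalWord t w).1) (M := 3) fun b _ => codeSize_bool_le b
  have h3 := codeSize_le_of_forall (l := (evalWord t w).2) (M := 3) fun b _ => codeSize_bool_le b
  have h4 := length_lt_codeSize w
  have h5 := codeSize_pair (evalWord t w).1 (evalWord t w).2
  rw [Prod.mk.eta] at h5
  omega

/-- Induction on the depth: a modality evaluates the remaining word in the successor types, which
are parts of the given type. The polynomial may depend on `d`, which is fixed; the intermediate
stacks are never longer than the word. -/
theorem PolyTime.evalWord_uncurried : ∀ d : ℕ,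
    PolyTime fun x : Ty d × List InputSymbol => evalWord x.1 x.2
  | 0 => by
    refine PolyTime.listRec (l := fun x : Ty 0 × List InputSymbol => x.2) (g := fun _ => ([], []))
      (h := fun x s _ r => _root_.evalStep x.1.val (fun _ => false) s r) (by fun_prop)
      (by fun_prop) (PolyTime.evalStep (by fun_prop) (by fun_prop) (by fun_prop) (by fun_prop))
      (f := fun x w => evalWord x.1 w) (fun _ => rfl) (fun _ _ _ => rfl)
      (4 * Polynomial.X + 3) fun x w hw => (codeSize_evalWord_le _ _).trans ?_
    have := codeSize_le_of_sublist hw.sublist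
    have := codeSize_pair x.1 x.2
    simp at *; omega
  | d + 1 => by
    have ih := PolyTime.evalWord_uncurried d
    refine PolyTime.listRec (l := fun x : Ty (d + 1) × List InputSymbol => x.2)
      (g := fun _ => ([], []))
      (h := fun x s w r => _root_.evalStep x.1.val (fun i => (x.1.succs.getD i []).all fun t' =>
        (evalWord t' w).2.headD false) s r) (by fun_prop)
      (by fun_prop) (PolyTime.evalStep (by fun_prop) ?_ (by fun_prop) (by fun_prop))
      (f := fun x w => evalWord x.1 w) (fun _ => rfl) (fun _ _ _ => rfl)
      (4 * Polynomial.X + 3) fun x w hw => (codeSize_evalWord_le _ _).trans ?_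
    · refine PolyTime.all (by fun_prop) (PolyTime.headD (PolyTime.comp_snd ?_) (by fun_prop))
      exact ih.comp (f := fun x : (((Ty (d + 1) × List InputSymbol) × InputSymbol ×
        List InputSymbol × (List Bool × List Bool)) × ℕ) × Ty d => (x.2, x.1.1.2.2.1))
        (by fun_prop)
    have := codeSize_le_of_sublist hw.sublist
    have := codeSize_pair x.1 x.2
    simp at *; omega

@[fun_prop]
theorem PolyTime.evalWord {d : ℕ} {f : α → Ty d} {g : α → List InputSymbol} (hf : PolyTime f)
    (hg : PolyTime g) : PolyTime fun a => _root_.evalWord (f a) (g a) :=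
  (PolyTime.evalWord_uncurried d).comp (hf.pair hg)

/-! ### The automaton of an instance, computed from its description

The functions are defined for arbitrary words; `m` is the number of agents. -/

namespace Planning

/-- The cardinalities, the initial world and the tables, as Boolean values. -/
def header (w : List InputSymbol) : List Bool := (evalWord (Ty.ofVal []) w).1

/-- The number of atoms. -/
def atoms (w : List InputSymbol) : ℕ := (readUnary (header w)).1

/-- The number of worlds. -/
def worlds (w : List InputSymbol) : ℕ := (readUnary (readUnary (header w)).2).1

/-- The number of events. -/
def events (w : List InputSymbol) : ℕ := (readUnary (readUnary (readUnary (header w)).2).2).1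

/-- The initial world. -/
def start (w : List InputSymbol) : ℕ :=
  (readUnary (readUnary (readUnary (readUnary (header w)).2).2).2).1

/-- The tables. -/
def tables (w : List InputSymbol) : List Bool :=
  (readUnary (readUnary (readUnary (readUnary (header w)).2).2).2).2

variable (m : ℕ)

/-- The accessibility relations of the epistemic model. -/
def relWorld (w : List InputSymbol) (i x y : ℕ) : Bool :=
  (tables w).getD ((i * worlds w + x) * worlds w + y) false

/-- The valuation. -/
def valWorld (w : List InputSymbol) (p x : ℕ) : Bool :=
  (tables w).getD (m * (worlds w * worlds w) + (p * worlds w + x)) false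

/-- The accessibility relations of the event model. -/
def relEvent (w : List InputSymbol) (i e e' : ℕ) : Bool :=
  (tables w).getD (m * (worlds w * worlds w) + (atoms w * worlds w +
    ((i * events w + e) * events w + e'))) false

/-- The events that plans may use. -/
def allowedEvent (w : List InputSymbol) (e : ℕ) : Bool :=
  (tables w).getD (m * (worlds w * worlds w) + (atoms w * worlds w +
    (m * (events w * events w) + e))) false

/-- The truth value of a precondition. -/
def preVal (w : List InputSymbol) (v : List ℕ) (e : ℕ) : Bool :=
  (evalWord (Ty.ofVal v) w).2.getD (e * (atoms w + 1)) false

/-- The truth value of a postcondition. -/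
def postVal (w : List InputSymbol) (v : List ℕ) (e p : ℕ) : Bool :=
  (evalWord (Ty.ofVal v) w).2.getD (e * (atoms w + 1) + (p + 1)) false

/-- The truth value of the goal. -/
def goalVal (w : List InputSymbol) {d : ℕ} (t : Ty d) : Bool :=
  (evalWord t w).2.getD (events w * (atoms w + 1)) false

/-- The lists of length `n` with elements in `l`. -/
def tuples {β : Type} (l : List β) : ℕ → List (List β)
  | 0 => [[]]
  | n + 1 => l.flatMap fun x => (tuples l n).map fun k => x :: k

/-- All types of depth `d`. -/
def allTypes : List InputSymbol → ∀ d, List (Ty d)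
  | w, 0 => (List.range (atoms w)).sublists'.map Ty.ofVal
  | w, d + 1 => (List.range (atoms w)).sublists'.flatMap fun v =>
      (tuples (allTypes w d).sublists' m).map fun ss => Ty.mk v ss

/-- The canonical list of the elements of a list of types. -/
def canonical (w : List InputSymbol) {d : ℕ} (l : List (Ty d)) : List (Ty d) :=
  (allTypes m w d).filter fun t => decide (t ∈ l)

/-- The true atoms in a world. -/
def initVal (w : List InputSymbol) (x : ℕ) : List ℕ :=
  (List.range (atoms w)).filter fun p => valWorld m w p x

/-- The type of a world of the epistemic model. -/
def initTy (w : List InputSymbol) : ∀ d, ℕ → Ty d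
  | 0, x => Ty.ofVal (initVal m w x)
  | d + 1, x => Ty.mk (initVal m w x) <| (List.range m).map fun i =>
      canonical m w <| ((List.range (worlds w)).filter fun y => relWorld w i x y).map fun y =>
        initTy w d y

/-- The true atoms after an event. -/
def updVal (w : List InputSymbol) (v : List ℕ) (e : ℕ) : List ℕ :=
  (List.range (atoms w)).filter fun p => postVal w v e p

/-- The type after an event. -/
def updTy (w : List InputSymbol) : ∀ d, Ty d → ℕ → Ty d
  | 0, t, e => Ty.ofVal (updVal w t.val e)
  | d + 1, t, e => Ty.mk (updVal w t.val e) <| (List.range m).map fun i =>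
      canonical m w <| (t.succs.getD i []).flatMap fun t' =>
        ((List.range (events w)).filter fun e' => relEvent m w i e e' && preVal w t'.val e').map
          fun e' => updTy w d t' e'

variable (k : ℕ)

/-- The transition function on the indices of types; the number of types is the index of the
sink. -/
def nextIdx (w : List InputSymbol) (s e : ℕ) : ℕ :=
  List.casesOn (motive := fun _ => ℕ) ((allTypes m w k).drop s) (allTypes m w k).length
    fun t _ => bif allowedEvent m w e && preVal w t.val e
      then (allTypes m w k).idxOf (updTy m w k t e) else (allTypes m w k).length

/-- Acceptance of the index of a type. -/
def acceptIdx (w : List InputSymbol) (s : ℕ) : Bool :=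
  List.casesOn (motive := fun _ => Bool) ((allTypes m w k).drop s) false fun t _ => goalVal w t

/-- The index of the initial type. -/
def startIdx (w : List InputSymbol) : ℕ := (allTypes m w k).idxOf (initTy m w k (start w))

/-- The description of the automaton. -/
def dfaWord (w : List InputSymbol) : List Bool :=
  DFA.unaryBool (events w) ++ DFA.unaryBool ((allTypes m w k).length + 1)
  ++ DFA.unaryBool (startIdx m k w)
  ++ ((List.range ((allTypes m w k).length + 1)).map fun s => acceptIdx m k w s)
  ++ ((List.range ((allTypes m w k).length + 1)).flatMap fun s =>
      (List.range (events w)).flatMap fun e => DFA.unaryBool (nextIdx m k w s e))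

/-- Add the states that are reached by one transition. -/
def reachStep (w : List InputSymbol) (l : List ℕ) : List ℕ :=
  (List.range ((allTypes m w k).length + 1)).filter fun s => decide (s ∈ l) ||
    l.any fun r => (List.range (events w)).any fun e => decide (nextIdx m k w r e = s)

/-- The reachable states. -/
def reachable (w : List InputSymbol) : List ℕ :=
  (List.range ((allTypes m w k).length + 1)).foldl (fun l _ => reachStep m k w l)
    ((List.range ((allTypes m w k).length + 1)).filter fun s => decide (s = startIdx m k w))

/-- The answer to the planning problem. -/
def answer (w : List InputSymbol) : List Bool := [(reachable m k w).any fun s => acceptIdx m k w s]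

@[fun_prop]
theorem _root_.PolyTime.unaryBool {f : α → ℕ} (hf : PolyTime f) :
    PolyTime fun a => DFA.unaryBool (f a) := by
  unfold DFA.unaryBool; fun_prop

/-! ### Polynomial time relative to the tables of types. -/

section polyTime

variable {m k} {w : α → List InputSymbol} (hw : PolyTime w)

@[fun_prop]
theorem polyTime_header (hw : PolyTime w) : PolyTime fun a => header (w a) := by
  unfold header; fun_prop

@[fun_prop]
theorem polyTime_atoms (hw : PolyTime w) : PolyTime fun a => atoms (w a) := by
  unfold atoms; fun_prop

@[fun_prop]
theorem polyTime_worlds (hw : PolyTime w) : PolyTime fun a => worlds (w a) := by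
  unfold worlds; fun_prop

@[fun_prop]
theorem polyTime_events (hw : PolyTime w) : PolyTime fun a => events (w a) := by
  unfold events; fun_prop

@[fun_prop]
theorem polyTime_start (hw : PolyTime w) : PolyTime fun a => start (w a) := by
  unfold start; fun_prop

@[fun_prop]
theorem polyTime_tables (hw : PolyTime w) : PolyTime fun a => tables (w a) := by
  unfold tables; fun_prop

@[fun_prop]
theorem polyTime_relWorld {i x y : α → ℕ} (hw : PolyTime w) (hi : PolyTime i) (hx : PolyTime x)
    (hy : PolyTime y) : PolyTime fun a => relWorld (w a) (i a) (x a) (y a) := by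
  unfold relWorld; fun_prop

@[fun_prop]
theorem polyTime_valWorld {p x : α → ℕ} (hw : PolyTime w) (hp : PolyTime p) (hx : PolyTime x) :
    PolyTime fun a => valWorld m (w a) (p a) (x a) := by
  unfold valWorld; fun_prop

@[fun_prop]
theorem polyTime_relEvent {i x y : α → ℕ} (hw : PolyTime w) (hi : PolyTime i) (hx : PolyTime x)
    (hy : PolyTime y) : PolyTime fun a => relEvent m (w a) (i a) (x a) (y a) := by
  unfold relEvent; fun_prop

@[fun_prop]
theorem polyTime_allowedEvent {x : α → ℕ} (hw : PolyTime w) (hx : PolyTime x) :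
    PolyTime fun a => allowedEvent m (w a) (x a) := by
  unfold allowedEvent; fun_prop

@[fun_prop]
theorem polyTime_preVal {v : α → List ℕ} {e : α → ℕ} (hw : PolyTime w) (hv : PolyTime v)
    (he : PolyTime e) : PolyTime fun a => preVal (w a) (v a) (e a) := by
  unfold preVal; fun_prop

@[fun_prop]
theorem polyTime_postVal {v : α → List ℕ} {e p : α → ℕ} (hw : PolyTime w) (hv : PolyTime v)
    (he : PolyTime e) (hp : PolyTime p) :
    PolyTime fun a => postVal (w a) (v a) (e a) (p a) := by
  unfold postVal; fun_prop

@[fun_prop]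
theorem polyTime_goalVal {d : ℕ} {t : α → Ty d} (hw : PolyTime w) (ht : PolyTime t) :
    PolyTime fun a => goalVal (w a) (t a) := by
  unfold goalVal; fun_prop

/-- The degree grows with `n`, which is harmless because `n` will be the fixed number of agents. -/
theorem polyTime_tuples (n : ℕ) : PolyTime fun l : List β => tuples l n := by
  induction n with
  | zero => exact PolyTime.const _
  | succ n ih =>
    refine PolyTime.flatMap (by fun_prop) (PolyTime.map ?_ (by fun_prop))
    exact ih.comp PolyTime.fst

@[fun_prop]
theorem polyTime_initVal {x : α → ℕ} (hw : PolyTime w) (hx : PolyTime x) :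
    PolyTime fun a => initVal m (w a) (x a) :=
  PolyTime.filter (by fun_prop) (by fun_prop)

@[fun_prop]
theorem polyTime_updVal {v : α → List ℕ} {e : α → ℕ} (hw : PolyTime w) (hv : PolyTime v)
    (he : PolyTime e) : PolyTime fun a => updVal (w a) (v a) (e a) :=
  PolyTime.filter (by fun_prop) (by fun_prop)

theorem polyTime_canonical {d : ℕ} {l : α → List (Ty d)}
    (hU : PolyTime fun a => allTypes m (w a) d) (hl : PolyTime l) :
    PolyTime fun a => canonical m (w a) (l a) :=
  PolyTime.filter hU (by fun_prop)

/-- The hypothesis `hU` sets aside the cost of the power sets: it holds when the code of the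
argument already contains the tables, as for `Env`. Only depths below `d` occur, since only sets of
successors are put in canonical form. -/
theorem polyTime_initTy (hw : PolyTime w) (d : ℕ)
    (hU : ∀ d' < d, PolyTime fun a => allTypes m (w a) d') :
    PolyTime fun x : α × ℕ => initTy m (w x.1) d x.2 := by
  induction d with
  | zero => unfold initTy; fun_prop
  | succ d ih =>
    have ih := ih fun d' hd => hU d' (by omega)
    unfold initTy
    refine Ty.polyTime_mk (by fun_prop) (PolyTime.map (by fun_prop) (polyTime_canonical
      (w := fun x : (α × ℕ) × ℕ => w x.1.1)
      ((hU d (by omega)).comp (f := fun x : (α × ℕ) × ℕ => x.1.1) (by fun_prop))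
      (PolyTime.map (PolyTime.filter (by fun_prop) (by fun_prop)) ?_)))
    exact ih.comp (f := fun x : ((α × ℕ) × ℕ) × ℕ => (x.1.1.1, x.2)) (by fun_prop)

theorem polyTime_updTy (hw : PolyTime w) (d : ℕ)
    (hU : ∀ d' < d, PolyTime fun a => allTypes m (w a) d') :
    PolyTime fun x : α × Ty d × ℕ => updTy m (w x.1) d x.2.1 x.2.2 := by
  induction d with
  | zero => unfold updTy; fun_prop
  | succ d ih =>
    have ih := ih fun d' hd => hU d' (by omega)
    unfold updTy
    refine Ty.polyTime_mk (by fun_prop) (PolyTime.map (by fun_prop) (polyTime_canonical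
      (w := fun x : (α × Ty (d + 1) × ℕ) × ℕ => w x.1.1)
      ((hU d (by omega)).comp (f := fun x : (α × Ty (d + 1) × ℕ) × ℕ => x.1.1) (by fun_prop))
      (PolyTime.flatMap (by fun_prop)
        (PolyTime.map (PolyTime.filter (by fun_prop) (by fun_prop)) ?_))))
    exact ih.comp (f := fun x : (((α × Ty (d + 1) × ℕ) × ℕ) × Ty d) × ℕ => (x.1.1.1.1, x.1.2, x.2))
      (by fun_prop)

end polyTime

/-! ### Transitions, description and emptiness test of the automaton, relative to the tables. -/

section automaton

variable {m k} {w : α → List InputSymbol} (hw : PolyTime w)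
  (hU : ∀ d ≤ k, PolyTime fun a => allTypes m (w a) d)
include hw hU

theorem polyTime_nextIdx : PolyTime fun x : α × ℕ × ℕ => nextIdx m k (w x.1) x.2.1 x.2.2 := by
  have h1 : PolyTime fun x : α × ℕ × ℕ => allTypes m (w x.1) k :=
    (hU k le_rfl).comp PolyTime.fst
  have h2 : PolyTime fun x : (α × ℕ × ℕ) × Ty k × List (Ty k) =>
      updTy m (w x.1.1) k x.2.1 x.1.2.2 :=
    (polyTime_updTy hw k fun d hd => hU d hd.le).comp
      (f := fun x : (α × ℕ × ℕ) × Ty k × List (Ty k) => (x.1.1, x.2.1, x.1.2.2)) (by fun_prop)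
  have h3 : PolyTime fun x : (α × ℕ × ℕ) × Ty k × List (Ty k) => allTypes m (w x.1.1) k :=
    h1.comp PolyTime.fst
  unfold nextIdx
  exact PolyTime.listCases (by fun_prop) (by fun_prop)
    (PolyTime.cond (by fun_prop) (h3.idxOf h2) (by fun_prop))

theorem polyTime_acceptIdx : PolyTime fun x : α × ℕ => acceptIdx m k (w x.1) x.2 := by
  have h1 : PolyTime fun x : α × ℕ => allTypes m (w x.1) k :=
    (hU k le_rfl).comp PolyTime.fst
  unfold acceptIdx
  exact PolyTime.listCases (by fun_prop) (by fun_prop) (by fun_prop)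

theorem polyTime_startIdx : PolyTime fun a => startIdx m k (w a) :=
  (hU k le_rfl).idxOf <| (polyTime_initTy hw k fun d hd => hU d hd.le).comp
    (f := fun a => (a, start (w a))) (by fun_prop)

theorem polyTime_dfaWord : PolyTime fun a => dfaWord m k (w a) := by
  have h1 := hU k le_rfl
  have h2 := polyTime_startIdx hw hU
  have h3 := polyTime_acceptIdx hw hU
  have h4 : PolyTime fun x : (α × ℕ) × ℕ => nextIdx m k (w x.1.1) x.1.2 x.2 :=
    (polyTime_nextIdx hw hU).comp (f := fun x : (α × ℕ) × ℕ => (x.1.1, x.1.2, x.2)) (by fun_prop)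
  unfold dfaWord
  refine PolyTime.append (PolyTime.append (by fun_prop) (PolyTime.map (by fun_prop) h3)) ?_
  exact PolyTime.flatMap (by fun_prop) (PolyTime.flatMap (by fun_prop) (by fun_prop))

theorem polyTime_reachStep : PolyTime fun x : α × List ℕ => reachStep m k (w x.1) x.2 := by
  have h1 : PolyTime fun x : α × List ℕ => allTypes m (w x.1) k :=
    (hU k le_rfl).comp PolyTime.fst
  have h4 : PolyTime fun x : (((α × List ℕ) × ℕ) × ℕ) × ℕ => nextIdx m k (w x.1.1.1.1) x.1.2 x.2 :=
    (polyTime_nextIdx hw hU).comp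
      (f := fun x : (((α × List ℕ) × ℕ) × ℕ) × ℕ => (x.1.1.1.1, x.1.2, x.2)) (by fun_prop)
  unfold reachStep
  exact PolyTime.filter (by fun_prop) (PolyTime.or (by fun_prop)
    (PolyTime.any (by fun_prop) (PolyTime.any (by fun_prop) (by fun_prop))))

theorem polyTime_answer : PolyTime fun a => answer m k (w a) := by
  have h1 := hU k le_rfl
  have h2 := polyTime_startIdx hw hU
  have h3 := polyTime_acceptIdx hw hU
  have h4 : PolyTime fun x : α × List ℕ × ℕ => reachStep m k (w x.1) x.2.1 :=
    (polyTime_reachStep hw hU).comp (f := fun x : α × List ℕ × ℕ => (x.1, x.2.1)) (by fun_prop)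
  have h5 : PolyTime fun a => List.range ((allTypes m (w a) k).length + 1) := by fun_prop
  obtain ⟨p, hp⟩ := h5.exists_codeSize_le
  have h6 : PolyTime fun a => reachable m k (w a) := by
    have h7 : PolyTime fun x : α × ℕ => startIdx m k (w x.1) := h2.comp PolyTime.fst
    -- Initially and after each round the value is a filtered list of all states, so its size stays
    -- below that of the list of all states.
    refine PolyTime.foldl h5 (PolyTime.filter h5 (by fun_prop)) h4 p fun a l _ => ?_
    refine le_trans (codeSize_le_of_sublist ?_) (hp a)
    rcases List.eq_nil_or_concat l with rfl | ⟨l', s, rfl⟩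
    · exact List.filter_sublist
    · rw [List.concat_eq_append, List.foldl_append]
      exact List.filter_sublist
  unfold answer
  have h7 := PolyTime.any (f := fun a s => acceptIdx m k (w a) s) h6 h3
  fun_prop

end automaton

/-! ### The table of all types -/

/-- A word, coded together with the lists of all types of depth at most `d`. -/
structure Env (m d : ℕ) where
  word : List InputSymbol

namespace Env

/-- The code of an environment. -/
def code (m : ℕ) (w : List InputSymbol) : ℕ → BinTree
  | 0 => .node (enc w) (enc (allTypes m w 0))
  | d + 1 => .node (code m w d) (enc (allTypes m w (d + 1)))

/-- The tables occur in the code only, not as fields. Looking one up is thus a projection, and time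
polynomial in the size of this code is time polynomial in the word and its tables. -/
instance (m d : ℕ) : TreeCode (Env m d) := ⟨fun x => code m x.word d⟩

theorem polyTime_pred (m d : ℕ) : PolyTime fun x : Env m (d + 1) => (⟨x.word⟩ : Env m d) := by
  have h : PolyTime fun x : Env m (d + 1) =>
      ((⟨x.word⟩, allTypes m x.word (d + 1)) : Env m d × List (Ty (d + 1))) :=
    PolyTime.of_enc_eq fun _ => rfl
  exact h.comp_fst

theorem polyTime_word (m d : ℕ) : PolyTime fun x : Env m d => x.word := by
  induction d with
  | zero =>
    have h : PolyTime fun x : Env m 0 =>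
        ((x.word, allTypes m x.word 0) : List InputSymbol × List (Ty 0)) :=
      PolyTime.of_enc_eq fun _ => rfl
    exact h.comp_fst
  | succ d ih => exact ih.comp (polyTime_pred m d)

theorem polyTime_allTypes_self (m d : ℕ) :
    PolyTime fun x : Env m d => allTypes m x.word d := by
  cases d with
  | zero =>
    have h : PolyTime fun x : Env m 0 =>
        ((x.word, allTypes m x.word 0) : List InputSymbol × List (Ty 0)) :=
      PolyTime.of_enc_eq fun _ => rfl
    exact h.comp_snd
  | succ d =>
    have h : PolyTime fun x : Env m (d + 1) =>
        ((⟨x.word⟩, allTypes m x.word (d + 1)) : Env m d × List (Ty (d + 1))) :=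
      PolyTime.of_enc_eq fun _ => rfl
    exact h.comp_snd

theorem polyTime_allTypes (m : ℕ) {d k : ℕ} (h : d ≤ k) :
    PolyTime fun x : Env m k => allTypes m x.word d := by
  induction h with
  | refl => exact polyTime_allTypes_self m d
  | step _ ih => exact ih.comp (polyTime_pred m _)

/-- Passing to the next depth takes one round of power sets, hence one more exponential; forming
tuples is polynomial since `m` is fixed. -/
theorem towerTime_mk (m d : ℕ) :
    TowerTime (d + 1) fun w : List InputSymbol => (⟨w⟩ : Env m d) := by
  induction d with
  | zero =>
    have h1 : TowerTime (1 + 0) fun w : List InputSymbol => (List.range (atoms w)).sublists' :=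
      towerTime_sublists'.comp (PolyTime.towerTime (by fun_prop) 0)
    have h2 : PolyTime fun x : List InputSymbol × List (List ℕ) => (x.1, x.2.map Ty.ofVal) :=
      PolyTime.pair (by fun_prop) (PolyTime.map (by fun_prop) (by fun_prop))
    have h3 : TowerTime (0 + 1) fun w : List InputSymbol => (w, allTypes m w 0) :=
      (h2.towerTime 0).comp ((PolyTime.id.towerTime 1).pair h1)
    obtain ⟨p, ⟨G, hG⟩, hs⟩ := h3
    exact ⟨p, ⟨G, hG⟩, hs⟩
  | succ d ih =>
    have h1 : TowerTime (1 + 0) fun x : Env m d => (allTypes m x.word d).sublists' :=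
      towerTime_sublists'.comp ((polyTime_allTypes_self m d).towerTime 0)
    have h0 : TowerTime (1 + 0) fun x : Env m d => (List.range (atoms x.word)).sublists' := by
      have := polyTime_word m d
      exact towerTime_sublists'.comp (PolyTime.towerTime (by fun_prop) 0)
    have h2 : PolyTime fun x : Env m d × List (List ℕ) × List (List (Ty d)) =>
        (x.1, x.2.1.flatMap fun v => (tuples x.2.2 m).map fun ss => Ty.mk v ss) := by
      refine PolyTime.pair (by fun_prop) (PolyTime.flatMap (by fun_prop)
        (PolyTime.map ?_ (by fun_prop)))
      exact (polyTime_tuples m).comp (f := fun x : (Env m d × List (List ℕ) ×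
        List (List (Ty d))) × List ℕ => x.1.2.2) (by fun_prop)
    have h3 : TowerTime (0 + 1) fun x : Env m d => (x, allTypes m x.word (d + 1)) :=
      (h2.towerTime 0).comp ((PolyTime.id.towerTime 1).pair (h0.pair h1))
    -- The pair of `h3` and the environment of depth `d + 1` have the same code, so the same program
    -- serves.
    have h4 : TowerTime (0 + 1) fun x : Env m d => (⟨x.word⟩ : Env m (d + 1)) := by
      obtain ⟨p, ⟨G, hG⟩, hs⟩ := h3
      exact ⟨p, ⟨G, hG⟩, hs⟩
    have h5 := h4.comp ih
    rwa [show 0 + 1 + (d + 1) = d + 1 + 1 by omega] at h5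

end Env

theorem towerTime_dfaWord (m k : ℕ) : TowerTime (k + 1) fun w => dfaWord m k w := by
  have h := (polyTime_dfaWord (Env.polyTime_word m k) fun d hd => Env.polyTime_allTypes m hd)
  have := (h.towerTime 0).comp (Env.towerTime_mk m k)
  rwa [Nat.zero_add] at this

theorem towerTime_answer (m k : ℕ) : TowerTime (k + 1) fun w => answer m k w := by
  have h := (polyTime_answer (Env.polyTime_word m k) fun d hd => Env.polyTime_allTypes m hd)
  have := (h.towerTime 0).comp (Env.towerTime_mk m k)
  rwa [Nat.zero_add] at this

end Planning

/-! ### The description of an instance is read correctly -/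

/-- Truth of a formula in a type. -/
def Ty.sat {m a : ℕ} : ∀ {d : ℕ}, Ty d → ELFormula (Fin m) (Fin a) → Bool
  | _, t, .atom p => decide ((p : ℕ) ∈ t.val)
  | _, t, .neg φ => !t.sat φ
  | _, t, .or φ ψ => t.sat φ || t.sat ψ
  | 0, _, .know _ _ => false
  | _ + 1, t, .know i φ => (t.succs.getD i []).all fun t' => t'.sat φ

/-! ### Evaluation of encoded bits and formulas. -/

section evalWord

variable {d : ℕ} (t : Ty d) (w : List InputSymbol)

theorem evalWord_zero : evalWord t (.zero :: w) = (false :: (evalWord t w).1, (evalWord t w).2) := by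
  cases d <;> rfl

theorem evalWord_one : evalWord t (.one :: w) = (true :: (evalWord t w).1, (evalWord t w).2) := by
  cases d <;> rfl

theorem evalWord_atom : evalWord t (.atom :: w) = ((readUnary (evalWord t w).1).2,
    decide ((readUnary (evalWord t w).1).1 ∈ t.val) :: (evalWord t w).2) := by
  cases d <;> rfl

theorem evalWord_neg : evalWord t (.neg :: w) =
    ((evalWord t w).1, (!(evalWord t w).2.headD false) :: (evalWord t w).2.tail) := by
  cases d <;> rfl

theorem evalWord_or : evalWord t (.or :: w) = ((evalWord t w).1,
    ((evalWord t w).2.headD false || (evalWord t w).2.tail.headD false) ::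
      (evalWord t w).2.tail.tail) := by
  cases d <;> rfl

/-- The symbols for zero and one. -/
def IsBits (u : List InputSymbol) : Prop := ∀ s ∈ u, s = .zero ∨ s = .one

/-- Symbols as Boolean values. -/
def toBools (u : List InputSymbol) : List Bool := u.map fun s => decide (s = .one)

theorem IsBits.flatMap {ι : Type} {l : List ι} {f : ι → List InputSymbol}
    (h : ∀ i, IsBits (f i)) : IsBits (l.flatMap f) := fun s hs => by
  obtain ⟨i, -, hi⟩ := List.mem_flatMap.1 hs
  exact h i s hi

theorem isBits_map_bit {ι : Type} (l : List ι) (P : ι → Prop) :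
    IsBits (l.map fun i => InputSymbol.bit (P i)) := fun s hs => by
  obtain ⟨i, -, rfl⟩ := List.mem_map.1 hs
  unfold InputSymbol.bit
  split_ifs <;> simp

theorem isBits_unary (n : ℕ) : IsBits (InputSymbol.unary n) := fun s hs => by
  rcases List.mem_append.1 hs with h | h
  · exact Or.inr (List.eq_of_mem_replicate h)
  · exact Or.inl (List.mem_singleton.1 h)

theorem decide_bit_eq_one (P : Prop) [Decidable P] :
    decide (InputSymbol.bit P = .one) = decide P := by
  unfold InputSymbol.bit
  by_cases h : P <;> simp [h]

theorem evalWord_append_of_isBits {u : List InputSymbol} (hu : IsBits u) :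
    evalWord t (u ++ w) = (toBools u ++ (evalWord t w).1, (evalWord t w).2) := by
  induction u with
  | nil => rfl
  | cons s u ih =>
    have ih := ih fun s hs => hu s (List.mem_cons_of_mem _ hs)
    rcases hu s List.mem_cons_self with rfl | rfl
    · rw [List.cons_append, evalWord_zero, ih]; rfl
    · rw [List.cons_append, evalWord_one, ih]; rfl

theorem readUnary_toBools_append (n : ℕ) (l : List Bool) :
    readUnary (toBools (InputSymbol.unary n) ++ l) = (n, l) := by
  induction n with
  | zero => rfl
  | succ n ih =>
    have : toBools (InputSymbol.unary (n + 1)) ++ l =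
      true :: (toBools (InputSymbol.unary n) ++ l) := rfl
    rw [this, readUnary, ih]

/-- From right to left, the operands of a connective are read before it. The unary number of an atom
or agent lies on top of the collected bits when its symbol is met and is consumed there, so the bits
of the tables survive. -/
theorem evalWord_encode_append {m a : ℕ} (φ : ELFormula (Fin m) (Fin a)) {d : ℕ} (t : Ty d)
    (w : List InputSymbol) :
    evalWord t (φ.encode ++ w) = ((evalWord t w).1, t.sat φ :: (evalWord t w).2) := by
  induction φ generalizing d w with
  | atom p =>
    rw [ELFormula.encode, List.cons_append, evalWord_atom,
      evalWord_append_of_isBits t w (isBits_unary _), readUnary_toBools_append]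
    cases d <;> rfl
  | neg φ ih =>
    rw [ELFormula.encode, List.cons_append, evalWord_neg, ih]
    cases d <;> rfl
  | or φ ψ ih₁ ih₂ =>
    rw [ELFormula.encode, List.cons_append, List.append_assoc, evalWord_or, ih₁, ih₂]
    cases d <;> rfl
  | know i φ ih =>
    have h := evalWord_append_of_isBits t (φ.encode ++ w) (isBits_unary i)
    rw [ih] at h
    rw [ELFormula.encode, List.cons_append, List.append_assoc]
    cases d with
    | zero =>
      rw [evalWord, h]
      simp only [evalStep, readUnary_toBools_append]
      rfl
    | succ d =>
      rw [evalWord, h]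
      simp only [evalStep, readUnary_toBools_append]
      congr 2
      rw [Ty.sat]
      congr 1
      funext t'
      -- In the successor type the suffix still begins with the number of the agent; these bits do
      -- not affect the stack of truth values.
      rw [evalWord_append_of_isBits t' _ (isBits_unary i), ih]
      rfl

theorem evalWord_flatMap_encode_append {m a : ℕ} (L : List (ELFormula (Fin m) (Fin a))) :
    evalWord t (L.flatMap ELFormula.encode ++ w) =
      ((evalWord t w).1, L.map t.sat ++ (evalWord t w).2) := by
  induction L with
  | nil => rfl
  | cons φ L ih =>
    rw [List.flatMap_cons, List.append_assoc, evalWord_encode_append, ih]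
    rfl

end evalWord

/-! ### Access to tables made of blocks of equal length. -/

section blocks

variable {ι β : Type} {f : ι → List β} {c : ℕ}

theorem length_flatMap_of_forall (hf : ∀ i, (f i).length = c) (l : List ι) :
    (l.flatMap f).length = l.length * c := by
  simp [List.length_flatMap, hf]

theorem getD_append_length_add (l l' : List β) (n j : ℕ) (hn : l.length = n) (x : β) :
    (l ++ l').getD (n + j) x = l'.getD j x := by
  subst hn
  rw [List.getD_append_right _ _ _ _ (Nat.le_add_right _ _), Nat.add_sub_cancel_left]

/-- Row-major addressing. The trailing list `r` allows for whatever follows the table. -/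
theorem getD_flatMap_finRange {n : ℕ} {f : Fin n → List β} (hf : ∀ i, (f i).length = c) (i : Fin n)
    {j : ℕ} (hj : j < c) (r : List β) (x : β) :
    (((List.finRange n).flatMap f) ++ r).getD (i * c + j) x = (f i).getD j x := by
  induction n with
  | zero => exact i.elim0
  | succ n ih =>
    rw [List.finRange_succ, List.flatMap_cons, List.append_assoc, List.flatMap_map]
    refine Fin.cases ?_ (fun i => ?_) i
    · rw [Fin.val_zero, Nat.zero_mul, Nat.zero_add, List.getD_append _ _ _ _ (by rwa [hf])]
    · rw [Fin.val_succ, Nat.succ_mul, Nat.add_comm (i * c) c, Nat.add_assoc,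
        getD_append_length_add _ _ _ _ (hf _)]
      exact ih (f := fun i => f i.succ) (fun i => hf _) i

theorem getD_map_finRange {n : ℕ} (f : Fin n → β) (i : Fin n) (r : List β) (x : β) :
    ((List.finRange n).map f ++ r).getD i x = f i := by
  rw [List.getD_append _ _ _ _ (by simp)]
  simp [List.getD_eq_getElem?_getD]

end blocks

/-! ### Decoding the description of an instance. -/

namespace Planning

variable {m : ℕ} (I : PlanningInstance m)

open InputSymbol in
/-- The tables of the description of an instance. -/
theorem header_encode_eq {d : ℕ} (t : Ty d) :
    evalWord t I.encode =
    (toBools (unary I.numAtoms) ++ (toBools (unary I.numWorlds) ++ (toBools (unary I.numEvents) ++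
      (toBools (unary I.start) ++
      (toBools ((List.finRange m).flatMap fun i => (List.finRange I.numWorlds).flatMap fun w =>
        (List.finRange I.numWorlds).map fun w' => bit (I.model.rel i w w')) ++
      (toBools ((List.finRange I.numAtoms).flatMap fun p =>
        (List.finRange I.numWorlds).map fun w => bit (w ∈ I.model.val p)) ++
      (toBools ((List.finRange m).flatMap fun i => (List.finRange I.numEvents).flatMap fun e =>
        (List.finRange I.numEvents).map fun e' => bit (I.eventModel.rel i e e')) ++
      (toBools ((List.finRange I.numEvents).map fun e => bit (e ∈ I.allowed)) ++ []))))))),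
    ((List.finRange I.numEvents).flatMap fun e => t.sat (I.eventModel.pre e) ::
      (List.finRange I.numAtoms).map fun p => t.sat (I.eventModel.post e p)) ++
      [t.sat I.goal]) := by
  -- As a single list of formulas, the conditions give one truth value each; every event then
  -- occupies a block of `I.numAtoms + 1` values, with the precondition first.
  have hF : ((List.finRange I.numEvents).flatMap fun e => (I.eventModel.pre e).encode
      ++ (List.finRange I.numAtoms).flatMap fun p => (I.eventModel.post e p).encode) =
      ((List.finRange I.numEvents).flatMap fun e => I.eventModel.pre e ::
        (List.finRange I.numAtoms).map fun p => I.eventModel.post e p).flatMap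
          ELFormula.encode := by
    rw [List.flatMap_assoc]
    congr 1
    funext e
    rw [List.flatMap_cons, List.flatMap_map]
  have hG : evalWord t I.goal.encode = ([], [t.sat I.goal]) := by
    have := evalWord_encode_append I.goal t []
    rwa [List.append_nil, evalWord_nil] at this
  unfold PlanningInstance.encode
  rw [hF]
  simp only [List.append_assoc]
  rw [evalWord_append_of_isBits _ _ (isBits_unary _), evalWord_append_of_isBits _ _ (isBits_unary _),
    evalWord_append_of_isBits _ _ (isBits_unary _), evalWord_append_of_isBits _ _ (isBits_unary _),
    evalWord_append_of_isBits _ _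
      (IsBits.flatMap fun _ => IsBits.flatMap fun _ => isBits_map_bit _ _),
    evalWord_append_of_isBits _ _ (IsBits.flatMap fun _ => isBits_map_bit _ _),
    evalWord_append_of_isBits _ _
      (IsBits.flatMap fun _ => IsBits.flatMap fun _ => isBits_map_bit _ _),
    evalWord_flatMap_encode_append, evalWord_append_of_isBits _ _ (isBits_map_bit _ _), hG]
  simp only [List.map_flatMap, List.map_cons, List.map_map]
  rfl

theorem atoms_encode : atoms I.encode = I.numAtoms := by
  simp only [atoms, header, header_encode_eq, readUnary_toBools_append]

theorem worlds_encode : worlds I.encode = I.numWorlds := by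
  simp only [worlds, header, header_encode_eq, readUnary_toBools_append]

theorem events_encode : events I.encode = I.numEvents := by
  simp only [events, header, header_encode_eq, readUnary_toBools_append]

theorem start_encode : start I.encode = I.start := by
  simp only [start, header, header_encode_eq, readUnary_toBools_append]

open Classical in
theorem tables_encode : tables I.encode =
    ((List.finRange m).flatMap fun i => (List.finRange I.numWorlds).flatMap fun w =>
      (List.finRange I.numWorlds).map fun w' => decide (I.model.rel i w w')) ++
    (((List.finRange I.numAtoms).flatMap fun p =>
      (List.finRange I.numWorlds).map fun w => decide (w ∈ I.model.val p)) ++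
    (((List.finRange m).flatMap fun i => (List.finRange I.numEvents).flatMap fun e =>
      (List.finRange I.numEvents).map fun e' => decide (I.eventModel.rel i e e')) ++
    (((List.finRange I.numEvents).map fun e => decide (e ∈ I.allowed)) ++ []))) := by
  simp only [tables, header, header_encode_eq, readUnary_toBools_append]
  simp only [toBools, List.map_flatMap, List.map_map, Function.comp_def, decide_bit_eq_one]

theorem relWorld_encode (i : Fin m) (x y : Fin I.numWorlds) :
    relWorld I.encode i x y = true ↔ I.model.rel i x y := by
  classical
  have h1 : (i * I.numWorlds + x) * I.numWorlds + y =
      i * (I.numWorlds * I.numWorlds) + (x * I.numWorlds + y) := by ring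
  have h2 : (x : ℕ) * I.numWorlds + y < I.numWorlds * I.numWorlds := by
    nlinarith [x.2, y.2, Nat.mul_le_mul_right I.numWorlds (Nat.succ_le_of_lt x.2)]
  have h3 := getD_flatMap_finRange (c := I.numWorlds) (f := fun w => (List.finRange I.numWorlds).map
    fun w' => decide (I.model.rel i w w')) (by simp) x y.2 [] false
  rw [List.append_nil] at h3
  rw [relWorld, worlds_encode, tables_encode, h1,
    getD_flatMap_finRange (by simp [List.length_flatMap]) i h2, h3]
  simp

theorem valWorld_encode (p : Fin I.numAtoms) (x : Fin I.numWorlds) :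
    valWorld m I.encode p x = true ↔ x ∈ I.model.val p := by
  classical
  rw [valWorld, worlds_encode, tables_encode,
    getD_append_length_add _ _ _ _ (by simp [List.length_flatMap]),
    getD_flatMap_finRange (by simp) p x.2]
  simp

theorem relEvent_encode (i : Fin m) (x y : Fin I.numEvents) :
    relEvent m I.encode i x y = true ↔ I.eventModel.rel i x y := by
  classical
  have h1 : (i * I.numEvents + x) * I.numEvents + y =
      i * (I.numEvents * I.numEvents) + (x * I.numEvents + y) := by ring
  have h2 : (x : ℕ) * I.numEvents + y < I.numEvents * I.numEvents := by
    nlinarith [x.2, y.2, Nat.mul_le_mul_right I.numEvents (Nat.succ_le_of_lt x.2)]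
  have h3 := getD_flatMap_finRange (c := I.numEvents) (f := fun w => (List.finRange I.numEvents).map
    fun w' => decide (I.eventModel.rel i w w')) (by simp) x y.2 [] false
  rw [List.append_nil] at h3
  rw [relEvent, worlds_encode, atoms_encode, events_encode, tables_encode, h1,
    getD_append_length_add _ _ _ _ (by simp [List.length_flatMap]),
    getD_append_length_add _ _ _ _ (by simp [List.length_flatMap]),
    getD_flatMap_finRange (by simp [List.length_flatMap]) i h2, h3]
  simp

theorem allowedEvent_encode (e : Fin I.numEvents) :
    allowedEvent m I.encode e = true ↔ e ∈ I.allowed := by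
  classical
  rw [allowedEvent, worlds_encode, atoms_encode, events_encode, tables_encode,
    getD_append_length_add _ _ _ _ (by simp [List.length_flatMap]),
    getD_append_length_add _ _ _ _ (by simp [List.length_flatMap]),
    getD_append_length_add _ _ _ _ (by simp [List.length_flatMap]), getD_map_finRange]
  simp

theorem preVal_encode (v : List ℕ) (e : Fin I.numEvents) :
    preVal I.encode v e = (Ty.ofVal v).sat (I.eventModel.pre e) := by
  have h := getD_flatMap_finRange (c := I.numAtoms + 1) (f := fun e =>
    (Ty.ofVal v).sat (I.eventModel.pre e) ::
      (List.finRange I.numAtoms).map fun p => (Ty.ofVal v).sat (I.eventModel.post e p))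
    (by simp) e (Nat.succ_pos _) [(Ty.ofVal v).sat I.goal] false
  rw [preVal, header_encode_eq, atoms_encode]
  exact h

theorem postVal_encode (v : List ℕ) (e : Fin I.numEvents) (p : Fin I.numAtoms) :
    postVal I.encode v e p = (Ty.ofVal v).sat (I.eventModel.post e p) := by
  have h := getD_flatMap_finRange (c := I.numAtoms + 1) (f := fun e =>
    (Ty.ofVal v).sat (I.eventModel.pre e) ::
      (List.finRange I.numAtoms).map fun p => (Ty.ofVal v).sat (I.eventModel.post e p))
    (by simp) e (Nat.succ_lt_succ p.2) [(Ty.ofVal v).sat I.goal] false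
  rw [postVal, header_encode_eq, atoms_encode]
  refine h.trans ?_
  have h' := getD_map_finRange (fun p => (Ty.ofVal v).sat (I.eventModel.post e p)) p [] false
  rw [List.append_nil] at h'
  rw [List.getD_cons_succ, h']

theorem goalVal_encode {d : ℕ} (t : Ty d) : goalVal I.encode t = t.sat I.goal := by
  rw [goalVal, header_encode_eq, atoms_encode, events_encode,
    ← Nat.add_zero (I.numEvents * (I.numAtoms + 1)),
    getD_append_length_add _ _ _ _ (by rw [length_flatMap_of_forall (c := I.numAtoms + 1) (by simp),
      List.length_finRange])]
  rfl

end Planning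

namespace Planning

variable {m : ℕ} (I : PlanningInstance m)

/-! ### The types of pointed models and their updates -/

theorem mem_tuples {β : Type} {l : List β} {n : ℕ} {k : List β} :
    k ∈ tuples l n ↔ k.length = n ∧ ∀ x ∈ k, x ∈ l := by
  induction n generalizing k with
  | zero => cases k <;> simp [tuples]
  | succ n ih =>
    cases k with
    | nil => simp [tuples]
    | cons x k => simp [tuples, ih]; tauto

open Classical in
/-- The true atoms in a world. -/
noncomputable def atomsAt {World : Type} (M : EpistemicModel (Fin m) (Fin I.numAtoms) World)
    (u : World) : List ℕ :=
  (List.range I.numAtoms).filter fun p => decide (∃ h : p < I.numAtoms, u ∈ M.val ⟨p, h⟩)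

open Classical in
/-- The type of a world. -/
noncomputable def typeAt {World : Type} (M : EpistemicModel (Fin m) (Fin I.numAtoms) World) :
    ∀ d, World → Ty d
  | 0, u => Ty.ofVal (atomsAt I M u)
  | d + 1, u => Ty.mk (atomsAt I M u) <| (List.range m).map fun i =>
      (allTypes m I.encode d).filter fun t =>
        decide (∃ h : i < m, ∃ u', M.rel ⟨i, h⟩ u u' ∧ typeAt M d u' = t)

section typeAt

variable {I} {World : Type} {M : EpistemicModel (Fin m) (Fin I.numAtoms) World} {u : World}

@[simp] theorem val_typeAt (d : ℕ) : (typeAt I M d u).val = atomsAt I M u := by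
  cases d <;> rfl

theorem mem_atomsAt (p : Fin I.numAtoms) : (p : ℕ) ∈ atomsAt I M u ↔ u ∈ M.val p := by
  simp [atomsAt]

theorem atomsAt_mem : atomsAt I M u ∈ (List.range (atoms I.encode)).sublists' := by
  rw [atoms_encode, List.mem_sublists']
  exact List.filter_sublist

/-- Sets of successors are filtered out of the list of all types, so they are sublists and occur
among its `sublists'`. -/
theorem typeAt_mem (d : ℕ) : typeAt I M d u ∈ allTypes m I.encode d := by
  cases d with
  | zero => exact List.mem_map.2 ⟨_, atomsAt_mem, rfl⟩
  | succ d =>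
    refine List.mem_flatMap.2 ⟨_, atomsAt_mem, List.mem_map.2 ⟨_, mem_tuples.2 ⟨?_, ?_⟩, rfl⟩⟩
    · simp
    · intro l hl
      obtain ⟨i, -, rfl⟩ := List.mem_map.1 hl
      exact List.mem_sublists'.2 List.filter_sublist

-- The restriction to `allTypes` in the definition loses nothing, because every type that is
-- realized belongs to that list.
open Classical in
theorem mem_succs_typeAt {d : ℕ} (i : Fin m) (t : Ty d) :
    t ∈ (typeAt I M (d + 1) u).succs.getD i [] ↔ ∃ u', M.rel i u u' ∧ typeAt I M d u' = t := by
  have : (typeAt I M (d + 1) u).succs.getD i [] = (allTypes m I.encode d).filter fun t =>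
      decide (∃ h : (i : ℕ) < m, ∃ u', M.rel ⟨i, h⟩ u u' ∧ typeAt I M d u' = t) := by
    rw [typeAt, Ty.succs_mk, List.getD_eq_getElem?_getD, List.getElem?_map,
      List.getElem?_range i.2]
    rfl
  rw [this, List.mem_filter]
  simp only [Fin.is_lt, exists_true_left, Fin.eta, decide_eq_true_eq, and_iff_right_iff_imp]
  rintro ⟨u', -, rfl⟩
  exact typeAt_mem d

/-- Each modality uses up one level of the type, and the bound on the depth excludes a modality at
level zero, where `Ty.sat` has an arbitrary value. -/
theorem sat_typeAt (φ : ELFormula (Fin m) (Fin I.numAtoms)) {d : ℕ} (h : φ.depth ≤ d) :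
    (typeAt I M d u).sat φ = true ↔ M.Sat u φ := by
  induction φ generalizing d u with
  | atom p => cases d <;> simpa [Ty.sat, EpistemicModel.Sat] using mem_atomsAt p
  | neg φ ih =>
    have := ih (u := u) (d := d) h
    cases d <;> simp [Ty.sat, EpistemicModel.Sat, ← this]
  | or φ ψ ih₁ ih₂ =>
    rw [ELFormula.depth, max_le_iff] at h
    have h₁ := ih₁ (u := u) h.1
    have h₂ := ih₂ (u := u) h.2
    cases d <;> simp [Ty.sat, EpistemicModel.Sat, ← h₁, ← h₂]
  | know i φ ih =>
    cases d with
    | zero => simp [ELFormula.depth] at h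
    | succ d =>
      rw [ELFormula.depth, Nat.succ_le_succ_iff] at h
      rw [Ty.sat, List.all_eq_true, EpistemicModel.Sat]
      constructor
      · intro H u' hu
        exact (ih h).1 (H _ ((mem_succs_typeAt i _).2 ⟨u', hu, rfl⟩))
      · intro H t ht
        obtain ⟨u', hu, rfl⟩ := (mem_succs_typeAt i t).1 ht
        exact (ih h).2 (H u' hu)

theorem sat_ofVal_atomsAt {φ : ELFormula (Fin m) (Fin I.numAtoms)} (h : φ.IsPropositional) :
    (Ty.ofVal (atomsAt I M u)).sat φ = true ↔ M.Sat u φ := by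
  have hd : φ.depth = 0 := by
    induction φ with
    | atom p => rfl
    | neg φ ih => exact ih h
    | or φ ψ ih₁ ih₂ => simp [ELFormula.depth, ih₁ h.1, ih₂ h.2]
    | know i φ => exact h.elim
  exact sat_typeAt (d := 0) φ hd.le

end typeAt

theorem initTy_encode (d : ℕ) (u : Fin I.numWorlds) :
    initTy m I.encode d u = typeAt I I.model d u := by
  have hv : ∀ u : Fin I.numWorlds, initVal m I.encode u = atomsAt I I.model u := fun u => by
    rw [initVal, atomsAt, atoms_encode]
    refine List.filter_congr fun p hp => ?_
    have hp : p < I.numAtoms := List.mem_range.1 hp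
    rw [Bool.eq_iff_iff]
    simp only [decide_eq_true_eq]
    rw [exists_prop_of_true hp]
    exact valWorld_encode I ⟨p, hp⟩ u
  induction d generalizing u with
  | zero => rw [initTy, typeAt, hv]
  | succ d ih =>
    rw [initTy, typeAt, hv]
    refine congrArg (Ty.mk _) (List.map_congr_left fun i hi => ?_)
    have hi : i < m := List.mem_range.1 hi
    -- Both sides filter the same list of all types, so it suffices that the same types are
    -- selected.
    refine List.filter_congr fun t _ => ?_
    rw [Bool.eq_iff_iff]
    simp only [decide_eq_true_eq]
    rw [exists_prop_of_true hi]
    simp only [List.mem_map, List.mem_filter, List.mem_range, worlds_encode]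
    constructor
    · rintro ⟨y, ⟨hy, hr⟩, rfl⟩
      exact ⟨⟨y, hy⟩, (relWorld_encode I ⟨i, hi⟩ u ⟨y, hy⟩).1 hr, (ih ⟨y, hy⟩).symm⟩
    · rintro ⟨u', hr, rfl⟩
      exact ⟨u', ⟨u'.2, (relWorld_encode I ⟨i, hi⟩ u u').2 hr⟩, ih u'⟩

variable {I}

section update

variable (hI : I.eventModel.IsPropositional)
  {World : Type} (M : EpistemicModel (Fin m) (Fin I.numAtoms) World)
include hI

theorem preVal_atomsAt (u : World) (e : Fin I.numEvents) :
    preVal I.encode (atomsAt I M u) e = true ↔ M.Sat u (I.eventModel.pre e) := by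
  rw [preVal_encode, sat_ofVal_atomsAt (hI e).1]

theorem updVal_atomsAt (u : World) (e : Fin I.numEvents) (h : M.Sat u (I.eventModel.pre e)) :
    updVal I.encode (atomsAt I M u) e = atomsAt I (M.update I.eventModel) ⟨(u, e), h⟩ := by
  rw [updVal, atomsAt, atoms_encode]
  refine List.filter_congr fun p hp => ?_
  have hp : p < I.numAtoms := List.mem_range.1 hp
  rw [Bool.eq_iff_iff]
  simp only [decide_eq_true_eq]
  rw [exists_prop_of_true hp]
  exact (postVal_encode I (atomsAt I M u) e ⟨p, hp⟩ ▸ sat_ofVal_atomsAt ((hI e).2 ⟨p, hp⟩))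

/-- The heart of the argument. Which pairs of successors survive the update is decided by
propositional preconditions, hence by the true atoms recorded in the successor types, and the types
of these pairs are given by the induction hypothesis. No level is lost. -/
theorem updTy_typeAt (d : ℕ) (u : World) (e : Fin I.numEvents)
    (h : M.Sat u (I.eventModel.pre e)) :
    updTy m I.encode d (typeAt I M d u) e =
      typeAt I (M.update I.eventModel) d ⟨(u, e), h⟩ := by
  induction d generalizing u e with
  | zero => rw [updTy, val_typeAt, updVal_atomsAt hI M u e h, typeAt]
  | succ d ih =>
    rw [updTy, val_typeAt, updVal_atomsAt hI M u e h, typeAt]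
    refine congrArg (Ty.mk _) (List.map_congr_left fun i hi => ?_)
    have hi : i < m := List.mem_range.1 hi
    refine List.filter_congr fun t _ => ?_
    rw [Bool.eq_iff_iff]
    simp only [decide_eq_true_eq]
    rw [exists_prop_of_true hi]
    simp only [List.mem_map, List.mem_flatMap, List.mem_filter, List.mem_range, events_encode,
      Bool.and_eq_true]
    constructor
    · rintro ⟨t', ht', e', ⟨he', hr, hp⟩, rfl⟩
      obtain ⟨u', hu, rfl⟩ := (mem_succs_typeAt ⟨i, hi⟩ t').1 ht'
      -- The test made on the type becomes the truth of the precondition at the successor world, so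
      -- that the pair is a world of the product.
      rw [val_typeAt] at hp
      have hp := (preVal_atomsAt hI M u' ⟨e', he'⟩).1 hp
      exact ⟨⟨(u', ⟨e', he'⟩), hp⟩, ⟨hu, (relEvent_encode I ⟨i, hi⟩ e ⟨e', he'⟩).1 hr⟩,
        (ih u' ⟨e', he'⟩ hp).symm⟩
    · rintro ⟨⟨⟨u', e'⟩, hp⟩, ⟨hu, hr⟩, rfl⟩
      refine ⟨typeAt I M d u', (mem_succs_typeAt ⟨i, hi⟩ _).2 ⟨u', hu, rfl⟩, e',
        ⟨e'.2, (relEvent_encode I ⟨i, hi⟩ e e').2 hr, ?_⟩, ih u' e' hp⟩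
      rw [val_typeAt]
      exact (preVal_atomsAt hI M u' e').2 hp

end update

/-! ### The automaton -/

theorem drop_idxOf {β : Type} [DecidableEq β] {l : List β} {x : β} (h : x ∈ l) :
    ∃ l', l.drop (l.idxOf x) = x :: l' := by
  have := List.drop_eq_getElem_cons (List.idxOf_lt_length_iff.2 h)
  rw [List.getElem_idxOf] at this
  exact ⟨_, this⟩

section index

variable (m) (k : ℕ) (w : List InputSymbol)

/-- A type is represented by the index of its first occurrence, so the table need not be known to be
free of repetitions. -/
theorem nextIdx_idxOf {t : Ty k} (h : t ∈ allTypes m w k) (e : ℕ) :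
    nextIdx m k w ((allTypes m w k).idxOf t) e =
      bif allowedEvent m w e && preVal w t.val e
      then (allTypes m w k).idxOf (updTy m w k t e) else (allTypes m w k).length := by
  obtain ⟨l', hl⟩ := drop_idxOf h
  rw [nextIdx, hl]

theorem acceptIdx_idxOf {t : Ty k} (h : t ∈ allTypes m w k) :
    acceptIdx m k w ((allTypes m w k).idxOf t) = goalVal w t := by
  obtain ⟨l', hl⟩ := drop_idxOf h
  rw [acceptIdx, hl]

/-- Beyond the end of the table the empty branch of the case distinction applies; this makes the
extra state absorbing. -/
theorem nextIdx_length (e : ℕ) :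
    nextIdx m k w (allTypes m w k).length e = (allTypes m w k).length := by
  rw [nextIdx, List.drop_length]

theorem acceptIdx_length : acceptIdx m k w (allTypes m w k).length = false := by
  rw [acceptIdx, List.drop_length]

theorem nextIdx_lt (s e : ℕ) : nextIdx m k w s e < (allTypes m w k).length + 1 := by
  rw [nextIdx]
  cases (allTypes m w k).drop s with
  | nil => exact Nat.lt_succ_self _
  | cons t l =>
    cases h : allowedEvent m w e && preVal w t.val e
    · simp [h]
    · simpa [h] using Nat.lt_succ_of_le List.idxOf_le_length

theorem startIdx_lt : startIdx m k w < (allTypes m w k).length + 1 :=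
  Nat.lt_succ_of_le List.idxOf_le_length

end index

variable (I) (k : ℕ)

/-- The number of states of the automaton of an instance. -/
noncomputable def numStates : ℕ := (allTypes m I.encode k).length + 1

/-- The automaton of an instance. -/
noncomputable def automaton : DFA (Fin I.numEvents) (Fin (numStates I k)) where
  step s e := ⟨nextIdx m k I.encode s e, nextIdx_lt m k _ s e⟩
  start := ⟨startIdx m k I.encode, startIdx_lt m k _⟩
  accept := {s | acceptIdx m k I.encode s = true}

/-- The state of a type. -/
noncomputable def stateOf (t : Ty k) : Fin (numStates I k) :=
  ⟨(allTypes m I.encode k).idxOf t, Nat.lt_succ_of_le List.idxOf_le_length⟩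

/-- The rejecting sink. -/
noncomputable def sink : Fin (numStates I k) := ⟨(allTypes m I.encode k).length, Nat.lt_succ_self _⟩

theorem evalFrom_sink (π : List (Fin I.numEvents)) :
    (automaton I k).evalFrom (sink I k) π = sink I k := by
  induction π with
  | nil => rfl
  | cons e π ih =>
    rw [DFA.evalFrom_cons]
    have : (automaton I k).step (sink I k) e = sink I k :=
      Fin.ext (nextIdx_length m k I.encode e)
    rw [this, ih]

variable {I k}

/-- The induction on the plan is over all pointed models at once, since an update changes the type
of worlds. -/
theorem evalFrom_stateOf (hI : I.eventModel.IsPropositional) (hk : I.goal.depth ≤ k)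
    (π : List (Fin I.numEvents)) {World : Type}
    (M : EpistemicModel (Fin m) (Fin I.numAtoms) World) (u : World) :
    (automaton I k).evalFrom (stateOf I k (typeAt I M k u)) π ∈ (automaton I k).accept ↔
      (∀ e ∈ π, e ∈ I.allowed) ∧ Achieves I.eventModel I.goal π M u := by
  induction π generalizing World with
  | nil =>
    have : acceptIdx m k I.encode ((allTypes m I.encode k).idxOf (typeAt I M k u)) = true ↔
        M.Sat u I.goal := by
      rw [acceptIdx_idxOf m k _ (typeAt_mem k), goalVal_encode, sat_typeAt _ hk]
    simpa [Achieves] using (show stateOf I k (typeAt I M k u) ∈ (automaton I k).accept ↔ _ from this)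
  | cons e π ih =>
    have hs := nextIdx_idxOf m k I.encode (typeAt_mem (I := I) (M := M) (u := u) k) e
    rw [val_typeAt] at hs
    rw [DFA.evalFrom_cons]
    by_cases ha : e ∈ I.allowed ∧ M.Sat u (I.eventModel.pre e)
    · obtain ⟨ha, hp⟩ := ha
      rw [(allowedEvent_encode I e).2 ha, (preVal_atomsAt hI M u e).2 hp,
        updTy_typeAt hI M k u e hp] at hs
      have : (automaton I k).step (stateOf I k (typeAt I M k u)) e =
          stateOf I k (typeAt I (M.update I.eventModel) k ⟨(u, e), hp⟩) := Fin.ext hs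
      rw [this, ih]
      simp [Achieves, ha, hp]
    -- A forbidden event and an undefined update product both lead to the sink, from which no word
    -- is accepted.
    · have hb : (allowedEvent m I.encode e && preVal I.encode (atomsAt I M u) e) = false := by
        rw [← Bool.not_eq_true, Bool.and_eq_true, allowedEvent_encode, preVal_atomsAt hI]
        exact ha
      rw [hb] at hs
      have : (automaton I k).step (stateOf I k (typeAt I M k u)) e = sink I k := Fin.ext hs
      rw [this, evalFrom_sink]
      constructor
      · intro h
        have h : acceptIdx m k I.encode (allTypes m I.encode k).length = true := h
        rw [acceptIdx_length] at h
        exact absurd h (by simp)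
      · rintro ⟨h1, h2, -⟩
        exact absurd ⟨h1 e List.mem_cons_self, h2⟩ ha

theorem automaton_accepts (hI : I.eventModel.IsPropositional) (hk : I.goal.depth ≤ k) :
    (automaton I k).accepts = I.solutionPlans := by
  ext π
  rw [DFA.mem_accepts, DFA.eval]
  have : (automaton I k).start = stateOf I k (typeAt I I.model k I.start) := by
    refine Fin.ext ?_
    change startIdx m k I.encode = _
    rw [startIdx, start_encode, initTy_encode]
    rfl
  rw [this, evalFrom_stateOf hI hk]
  rfl

theorem dfaWord_encode : dfaWord m k I.encode = (automaton I k).encodeFin := by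
  classical
  have h1 : ∀ (n : ℕ) (f : ℕ → List Bool),
      (List.range n).flatMap f = (List.finRange n).flatMap fun i : Fin n => f i := fun n f => by
    rw [← List.map_coe_finRange_eq_range, List.flatMap_map]
  have h2 : ∀ (n : ℕ) (f : ℕ → Bool),
      (List.range n).map f = (List.finRange n).map fun i : Fin n => f i := fun n f => by
    rw [← List.map_coe_finRange_eq_range, List.map_map]
    rfl
  rw [dfaWord, DFA.encodeFin, h1, h2]
  simp only [h1, events_encode]
  congr 2
  congr 1
  funext s
  rw [Bool.eq_iff_iff, decide_eq_true_eq]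
  rfl

end Planning

namespace Planning

variable {m : ℕ} {I : PlanningInstance m} {k : ℕ}

/-! ### The emptiness test -/

/-- Each round keeps the states already found and follows one more transition; this is the invariant
of breadth-first search. -/
theorem mem_iterate_reachStep (j s : ℕ) :
    s ∈ (reachStep m k I.encode)^[j]
      ((List.range ((allTypes m I.encode k).length + 1)).filter fun s =>
        decide (s = startIdx m k I.encode)) ↔
    ∃ π : List (Fin I.numEvents), π.length ≤ j ∧ ((automaton I k).eval π : ℕ) = s := by
  induction j generalizing s with
  | zero =>
    simp only [Function.iterate_zero, id, List.mem_filter, List.mem_range, decide_eq_true_eq,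
      Nat.le_zero, List.length_eq_zero_iff, exists_eq_left, DFA.eval_nil]
    refine ⟨fun h => h.2.symm, fun h => ⟨?_, h.symm⟩⟩
    exact h ▸ startIdx_lt m k _
  | succ j ih =>
    rw [Function.iterate_succ_apply', reachStep]
    simp only [List.mem_filter, List.mem_range, Bool.or_eq_true, decide_eq_true_eq, List.any_eq_true,
      ih, events_encode]
    constructor
    · rintro ⟨-, ⟨π, hπ, rfl⟩ | ⟨r, ⟨π, hπ, rfl⟩, e, he, rfl⟩⟩
      · exact ⟨π, by omega, rfl⟩
      · refine ⟨π ++ [⟨e, he⟩], by simpa using hπ, ?_⟩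
        rw [DFA.eval_append_singleton]
        rfl
    · rintro ⟨π, hπ, rfl⟩
      refine ⟨((automaton I k).eval π).2, ?_⟩
      rcases List.eq_nil_or_concat π with rfl | ⟨π', e, rfl⟩
      · exact Or.inl ⟨[], Nat.zero_le _, rfl⟩
      · refine Or.inr ⟨_, ⟨π', by simpa using hπ, rfl⟩, e, e.2, ?_⟩
        rw [List.concat_eq_append, DFA.eval_append_singleton]
        rfl

/-- A word at least as long as the number of states repeats a state, and the loop in between can be
cut out. So as many rounds of search as there are states suffice. -/
theorem exists_short_mem_accepts {ι : Type} {q : ℕ} (A : DFA ι (Fin q)) (π : List ι)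
    (h : π ∈ A.accepts) : ∃ π' ∈ A.accepts, π'.length ≤ q := by
  induction hn : π.length using Nat.strong_induction_on generalizing π with
  | _ n ih =>
    subst hn
    by_cases hq : π.length ≤ q
    · exact ⟨π, h, hq⟩
    · obtain ⟨s, a, b, c, rfl, -, hb, ha, -, hc⟩ :=
        A.evalFrom_split (by simpa using (not_le.1 hq).le) (rfl : A.evalFrom A.start π = _)
      refine ih (a ++ c).length ?_ (a ++ c) ?_ rfl
      · have := List.length_pos_iff.2 hb
        simp only [List.length_append]
        omega
      · rw [DFA.mem_accepts, DFA.eval, DFA.evalFrom_of_append, ha, hc]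
        exact h

open Classical in
theorem answer_encode (hI : I.eventModel.IsPropositional) (hk : I.goal.depth ≤ k) :
    answer m k I.encode = [decide I.Solvable] := by
  rw [answer, List.cons.injEq, Bool.eq_iff_iff, decide_eq_true_eq, List.any_eq_true]
  refine ⟨?_, rfl⟩
  -- The fold ignores the elements of its list and is an iterate, with as many rounds as the
  -- automaton has states.
  rw [reachable, List.foldl_const, List.length_range, PlanningInstance.Solvable,
    ← automaton_accepts hI hk]
  simp only [mem_iterate_reachStep]
  constructor
  · rintro ⟨s, ⟨π, -, rfl⟩, hs⟩
    exact ⟨π, hs⟩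
  · rintro ⟨π, hπ⟩
    obtain ⟨π', h, hl⟩ := exists_short_mem_accepts _ π hπ
    exact ⟨_, ⟨π', hl, rfl⟩, h⟩

/-! ### The length of the description -/

theorem length_unary (n : ℕ) : (InputSymbol.unary n).length = n + 1 := by
  simp [InputSymbol.unary]

/-- Each atom, connective or modality contributes its symbol and at most one unary number below `m`
or `a`. -/
theorem length_encode_le {a : ℕ} (φ : ELFormula (Fin m) (Fin a)) :
    φ.encode.length ≤ φ.size * (m + a + 2) := by
  induction φ with
  | atom p =>
    have := p.2
    simp only [ELFormula.encode, ELFormula.size, List.length_cons, length_unary]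
    omega
  | neg φ ih =>
    simp only [ELFormula.encode, ELFormula.size, List.length_cons]
    linarith
  | or φ ψ ih₁ ih₂ =>
    simp only [ELFormula.encode, ELFormula.size, List.length_cons, List.length_append]
    linarith
  | know i φ ih =>
    have := i.2
    simp only [ELFormula.encode, ELFormula.size, List.length_cons, List.length_append, length_unary]
    linarith

theorem one_le_size {a : ℕ} (φ : ELFormula (Fin m) (Fin a)) : 1 ≤ φ.size := by
  cases φ <;> simp [ELFormula.size]

/-- The summands follow the encoding: four unary numbers, three tables with at most quadratically
many entries (up to the constant `m`), the conditions, the allowed events and the goal. -/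
theorem length_encode_instance_le (I : PlanningInstance m) :
    I.encode.length ≤ (4 * (Polynomial.X + 1) + Polynomial.C m * Polynomial.X ^ 2 +
      Polynomial.X ^ 2 + Polynomial.C m * Polynomial.X ^ 2 +
      Polynomial.X * (Polynomial.C m + Polynomial.X + 2) + Polynomial.X +
      Polynomial.X * (Polynomial.C m + Polynomial.X + 2) : Polynomial ℕ).eval I.size := by
  have hF : ((List.finRange I.numEvents).flatMap fun e => (I.eventModel.pre e).encode ++
      (List.finRange I.numAtoms).flatMap fun p => (I.eventModel.post e p).encode).length ≤
      (∑ e, ((I.eventModel.pre e).size + ∑ p, (I.eventModel.post e p).size)) *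
        (m + I.numAtoms + 2) := by
    rw [List.length_flatMap, ← Fin.sum_univ_def, Finset.sum_mul]
    refine Finset.sum_le_sum fun e _ => ?_
    rw [List.length_append, List.length_flatMap, ← Fin.sum_univ_def, add_mul, Finset.sum_mul]
    exact add_le_add (length_encode_le _) (Finset.sum_le_sum fun p _ => length_encode_le _)
  -- The size has no summand for the number of events; it is bounded through the preconditions, each
  -- of size at least 1.
  have hE : I.numEvents ≤ ∑ e, ((I.eventModel.pre e).size + ∑ p, (I.eventModel.post e p).size) :=
    calc I.numEvents = ∑ _e : Fin I.numEvents, 1 := by simp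
      _ ≤ _ := Finset.sum_le_sum fun e _ =>
        (one_le_size (I.eventModel.pre e)).trans (Nat.le_add_right _ _)
  have hs : I.size = (I.numWorlds +
      ∑ i, Set.ncard {x : Fin I.numWorlds × Fin I.numWorlds | I.model.rel i x.1 x.2})
    + (∑ i, Set.ncard {x : Fin I.numEvents × Fin I.numEvents | I.eventModel.rel i x.1 x.2}
      + ∑ e, ((I.eventModel.pre e).size + ∑ p, (I.eventModel.post e p).size))
    + I.allowed.ncard + I.goal.size + I.numAtoms := rfl
  have hG := length_encode_le I.goal
  have hst := I.start.2
  generalize ∑ e, ((I.eventModel.pre e).size + ∑ p, (I.eventModel.post e p).size) = f at *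
  have h1 : I.numWorlds ≤ I.size := by omega
  have h2 : I.numEvents ≤ I.size := by omega
  have h3 : I.numAtoms ≤ I.size := by omega
  have h4 : f ≤ I.size := by omega
  have h5 : I.goal.size ≤ I.size := by omega
  have h6 : (I.start : ℕ) ≤ I.size := by omega
  clear hs hE
  have e1 : m * (I.numWorlds * I.numWorlds) ≤ m * I.size ^ 2 := by
    rw [sq]; gcongr
  have e2 : I.numAtoms * I.numWorlds ≤ I.size ^ 2 := by
    rw [sq]; gcongr
  have e3 : m * (I.numEvents * I.numEvents) ≤ m * I.size ^ 2 := by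
    rw [sq]; gcongr
  have e4 : f * (m + I.numAtoms + 2) ≤ I.size * (m + I.size + 2) := by gcongr
  have e5 : I.goal.size * (m + I.numAtoms + 2) ≤ I.size * (m + I.size + 2) := by gcongr
  have c1 : ∀ (n r : ℕ) (P : Fin r → Fin n → Fin n → Prop), ((List.finRange r).flatMap fun i =>
      (List.finRange n).flatMap fun w => (List.finRange n).map fun w' =>
        InputSymbol.bit (P i w w')).length = r * (n * n) := fun n r P => by
    simp [List.length_flatMap]
  have c2 : ∀ (n r : ℕ) (P : Fin r → Fin n → Prop), ((List.finRange r).flatMap fun i =>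
      (List.finRange n).map fun w => InputSymbol.bit (P i w)).length = r * n := fun n r P => by
    simp [List.length_flatMap]
  unfold PlanningInstance.encode
  simp only [List.length_append, length_unary, c1, c2, List.length_map, List.length_finRange,
    Polynomial.eval_add, Polynomial.eval_mul, Polynomial.eval_X, Polynomial.eval_C,
    Polynomial.eval_pow, Polynomial.eval_ofNat, Polynomial.eval_one]
  linarith

end Planning

/-! ### The complexity theorem. -/

theorem theorem2 (m k : ℕ) :
    InExpTime (k + 1)
      (fun I : PropPlanningInstance m k => I.1.encode) (fun I => I.1.size)
      (fun I => I.1.Solvable) ∧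
    ∃ (q : PropPlanningInstance m k → ℕ)
      (A : ∀ I : PropPlanningInstance m k, DFA (Fin I.1.numEvents) (Fin (q I))),
      (∀ I, (A I).accepts = I.1.solutionPlans) ∧
      ComputableInExpTime (k + 1)
        (fun I : PropPlanningInstance m k => I.1.encode) (fun I => I.1.size)
        (fun I => (A I).encodeFin) := by
  constructor
  · have h := (Planning.towerTime_answer m k).computableInExpTime
      (e := fun I : PropPlanningInstance m k => I.1.encode) _
      fun I => Planning.length_encode_instance_le I.1
    have h' : (fun I : PropPlanningInstance m k => Planning.answer m k I.1.encode) = _ :=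
      funext fun I => Planning.answer_encode I.2.1 I.2.2
    rw [h'] at h
    exact h
  · refine ⟨fun I => Planning.numStates I.1 k, fun I => Planning.automaton I.1 k,
      fun I => Planning.automaton_accepts I.2.1 I.2.2, ?_⟩
    have h := (Planning.towerTime_dfaWord m k).computableInExpTime
      (e := fun I : PropPlanningInstance m k => I.1.encode) _
      fun I => Planning.length_encode_instance_le I.1
    have h' : (fun I : PropPlanningInstance m k => Planning.dfaWord m k I.1.encode) = _ :=
      funext fun I => Planning.dfaWord_encode
    rw [h'] at h
    exact h
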